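/- Let $m$ be an integer that is not divisible by $d^{12}$ for any integer $d\ge 2$, let $x^{12}-m$ be irreducible over $\mathbb{Q}$, and let $K=\mathbb{Q}(\theta)$ with $\theta^{12}=m$. Let $O_K$ be the ring of integers of $K$ and let $\operatorname{ind}\theta=[O_K:\mathbb{Z}[\theta]]$, which is finite. For a prime $p$, let $v_p$ be the $p$-adic valuation, let $\mathbb{Z}_{(p)}$ be the localization of $\mathbb{Z}$ at $p\mathbb{Z}$, and call a basis over $\mathbb{Z}_{(p)}$ of the integral closure of $\mathbb{Z}_{(p)}$ in $K$ a $p$-integral basis of $K$. Then the following hold for every prime $p$. (1) If $p\mid m$ and $p\nmid v_p(m)$, then $$v_p(\operatorname{ind}\theta)=\tfrac12\bigl[11(v_p(m)-1)+(\gcd(v_p(m),12)-1)\bigr],$$ and $\left\{\theta^i/p^{\lfloor i v_p(m)/12\rfloor} : 1\le i\le 12\right\}$ is a $p$-integral basis of $K$. (2) Let $p=3$ and $3\nmid m$. If $m^2\equiv 1\pmod 9$, then $v_3(\operatorname{ind}\theta)=4$ and $$1,\theta,\dots,\theta^7,\ \tfrac{h(\theta)}{3},\ \tfrac{\theta h(\theta)}{3},\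 \tfrac{\theta^2h(\theta)}{3},\ \tfrac{\theta^3h(\theta)}{3},\qquad h(\theta)=\theta^8+m\theta^4+1,$$ is a $3$-integral basis of $K$. If $m^2\not\equiv 1\pmod 9$, then $v_3(\operatorname{ind}\theta)=0$ and $1,\theta,\dots,\theta^{11}$ is a $3$-integral basis of $K$. (3) Let $p=2$ and $2\nmid m$. If $m\equiv 1\pmod 8$, then $v_2(\operatorname{ind}\theta)=9$ and $$1,\theta,\dots,\theta^5,\ \tfrac{\theta^6-1}{2},\ \tfrac{\theta(\theta^6-1)}{2},\ \tfrac{\theta^2(\theta^6-1)}{2},\ \tfrac{g(\theta)}{4},\ \tfrac{\theta g(\theta)}{4},\ \tfrac{\theta^2g(\theta)}{4},\qquad g(\theta)=\theta^9+\theta^6+\theta^3+1,$$ is a $2$-integral basis of $K$. If $m\equiv 5\pmod 8$, then $v_2(\operatorname{ind}\theta)=6$ and $$1,\theta,\dots,\theta^5,\ \tfrac{\theta^6-1}{2},\ \tfrac{\theta(\theta^6-1)}{2},\ \dots,\ \tfrac{\theta^5(\theta^6-1)}{2}$$ is a $2$-integral basis of $K$. If $m\equiv 3\pmod 4$, then $v_2(\operatorname{ind}\theta)=0$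 and $1,\theta,\dots,\theta^{11}$ is a $2$-integral basis of $K$. (4) If $p\nmid 12m$, then $v_p(\operatorname{ind}\theta)=0$ and $1,\theta,\dots,\theta^{11}$ is a $p$-integral basis of $K$. -/

import Mathlib

/-- The localization `ℤ_(p)` of `ℤ` at the prime ideal `pℤ`, as a subring of `ℚ`: the rational
numbers whose reduced denominator is prime to `p`. -/
def localizedIntegers (p : ℕ) : Subring ℚ where
  carrier := {q | Nat.Coprime p q.den}
  mul_mem' {a b} ha hb :=
    Nat.Coprime.coprime_dvd_right (Rat.mul_den_dvd a b) (Nat.Coprime.mul_right ha hb)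
  one_mem' := by simp
  add_mem' {a b} ha hb :=
    Nat.Coprime.coprime_dvd_right (Rat.add_den_dvd a b) (Nat.Coprime.mul_right ha hb)
  zero_mem' := by simp
  neg_mem' {a} ha := by simpa using ha

/-- A family `b` of elements of `K` is a `p`-integral basis of `K` if it is a basis, over `ℤ_(p)`,
of the module of elements of `K` that are integral over `ℤ_(p)`. -/
def IsPIntegralBasis (p : ℕ) {K : Type*} [Field K] [CharZero K] {ι : Type*} (b : ι → K) : Prop :=
  LinearIndependent (localizedIntegers p) b ∧
    Submodule.span (localizedIntegers p) (Set.range b) =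
      Subalgebra.toSubmodule (integralClosure (localizedIntegers p) K)

/-- The index `[O_K : ℤ[θ]]` of the additive group `ℤ[θ]` in the ring of integers of `K`, for an
algebraic integer `θ` of `K` (with value `0` if the index is infinite). -/
noncomputable def integerIndex {K : Type*} [Field K] (θ : K) : ℕ :=
  (Subalgebra.toSubmodule (Algebra.adjoin ℤ {θ})).toAddSubgroup.relIndex
    (Subalgebra.toSubmodule (integralClosure ℤ K)).toAddSubgroup

/-!
Every element of `K` is `x = ∑ cᵢ θⁱ` with `i < 12` and `cᵢ ∈ ℚ`. If `x` is integral over `ℤ_(p)`,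
then `∑ cᵢ tⁱ` is integral for every 12th root `t` of `m` in an algebraic closure of `ℚ_p`; as the
closure carries a multiplicative ultrametric norm, this is the bound `‖∑ cᵢ tⁱ‖ ≤ 1`. These bounds
determine the possible coefficients, so no maximality criterion for orders is needed.

* For `N ∣ 12` prime to `p`, averaging over the conjugations `t ↦ ζ t` with `ζ ^ N = 1` shows that
  for each residue `r` the part of the sum with `i ≡ r` modulo `N` is integral
  (`sum_filter_mod_mem_unitBall`).
* If `p ∤ v_p(m)`, the terms within such a part, for the largest `N`, have valuations that are
  distinct modulo `1`, so each term is integral by itself (`mul_pow_mem_of_sum_mem_unitBall`). If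
  `p ∤ 12 m`, then `N = 12` works and each part has just one term.
* If `p = 3 ∤ m`, with `N = 4`, or `p = 2 ∤ m`, with `N = 3`, the problem becomes the one for the pure
  cubic field of `s = θ ^ 4`, or the pure quartic field of `s = θ ^ 3`. When the shifted element
  `s - m`, or `s - 1`, is a root of an Eisenstein polynomial, valuations are again distinct. In the
  other cases symmetric functions of the conjugates give explicit congruences.

The index is the absolute value of the determinant of the powers of `θ` with respect to a `ℤ`-basis
of the ring of integers. A `p`-integral basis differs from that `ℤ`-basis by a matrix invertible over
`ℤ_(p)`, and it is triangular in the powers of `θ`, so the valuation of the index is the sum of the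
exponents of the denominators (`padicValNat_integerIndex_eq_sum`).
-/

/-! ### The `p`-adic norm on an algebraic closure of `ℚ_p` -/

section Norm

variable {p : ℕ} [Fact p.Prime]

theorem norm_ratCast_padicAlgCl (q : ℚ) : ‖(q : PadicAlgCl p)‖ = (padicNorm p q : ℝ) := by
  rw [← map_ratCast (algebraMap ℚ_[p] (PadicAlgCl p)), PadicAlgCl.norm_extends,
    Padic.eq_padicNorm]

theorem norm_ratCast_eq_zpow {q : ℚ} (hq : q ≠ 0) :
    ‖(q : PadicAlgCl p)‖ = (p : ℝ) ^ (-padicValRat p q) := by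
  rw [norm_ratCast_padicAlgCl, padicNorm.eq_zpow_of_nonzero hq]
  push_cast
  rfl

theorem norm_ratCast_le_one_iff {q : ℚ} :
    ‖(q : PadicAlgCl p)‖ ≤ 1 ↔ q ∈ localizedIntegers p := by
  rw [← map_ratCast (algebraMap ℚ_[p] (PadicAlgCl p)), PadicAlgCl.norm_extends,
    Padic.norm_rat_le_one_iff_padicValuation_le_one, Rat.padicValuation_le_one_iff,
    ← Nat.Prime.coprime_iff_not_dvd Fact.out]
  rfl

theorem norm_intCast_le_one (a : ℤ) : ‖(a : PadicAlgCl p)‖ ≤ 1 := by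
  have := (norm_ratCast_le_one_iff (p := p) (q := a)).2 (intCast_mem _ a)
  simpa using this

theorem norm_intCast_eq_one {a : ℤ} (ha : ¬ (p : ℤ) ∣ a) : ‖(a : PadicAlgCl p)‖ = 1 := by
  have h := norm_ratCast_padicAlgCl (p := p) (a : ℚ)
  rw [padicNorm.int_eq_one_iff a |>.2 ha] at h
  simpa using h

theorem norm_natCast_eq_one {a : ℕ} (ha : ¬ p ∣ a) : ‖(a : PadicAlgCl p)‖ = 1 := by
  have := norm_intCast_eq_one (p := p) (a := a) (by exact_mod_cast ha)
  simpa using this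

theorem norm_p_padicAlgCl : ‖(p : PadicAlgCl p)‖ = (p : ℝ)⁻¹ := by
  have h := norm_ratCast_padicAlgCl (p := p) (p : ℚ)
  rw [padicNorm.padicNorm_p_of_prime] at h
  simpa using h

variable (p) in
/-- The valuation ring of `PadicAlgCl p`, the closed unit ball. -/
noncomputable def unitBall : Subring (PadicAlgCl p) := (PadicAlgCl.valued p).v.integer

theorem mem_unitBall {x : PadicAlgCl p} : x ∈ unitBall p ↔ ‖x‖ ≤ 1 := Iff.rfl

theorem ratCast_mem_unitBall {q : ℚ} :
    (q : PadicAlgCl p) ∈ unitBall p ↔ q ∈ localizedIntegers p :=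
  norm_ratCast_le_one_iff

theorem mem_unitBall_of_isIntegral {x : PadicAlgCl p}
    (hx : IsIntegral (localizedIntegers p) x) : x ∈ unitBall p := by
  have hmem : ∀ r : localizedIntegers p,
      algebraMap (localizedIntegers p) (PadicAlgCl p) r ∈ (PadicAlgCl.valued p).v.integer := by
    intro r
    have := ratCast_mem_unitBall.2 r.2
    exact this
  refine (Valuation.integer.integers (PadicAlgCl.valued p).v).mem_of_integral ?_
  have := IsIntegral.map_of_comp_eq (S := PadicAlgCl p)
    (φ := RingHom.codRestrict (algebraMap (localizedIntegers p) (PadicAlgCl p)) _ hmem)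
    (ψ := RingHom.id _) (by ext; rfl) hx
  exact this

/-- The summands of an integral sum are integral if their nonzero norms are distinct. -/
theorem norm_le_one_of_norm_sum_le_one {ι : Type*} (T : Finset ι) (f : ι → PadicAlgCl p)
    (hinj : ∀ i ∈ T, ∀ j ∈ T, f i ≠ 0 → f j ≠ 0 → ‖f i‖ = ‖f j‖ → i = j)
    (h : ‖∑ i ∈ T, f i‖ ≤ 1) : ∀ i ∈ T, ‖f i‖ ≤ 1 := by
  intro i hi
  obtain ⟨k, hk, hmax⟩ := T.exists_max_image (fun i => ‖f i‖) ⟨i, hi⟩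
  by_cases hk0 : f k = 0
  · have := hmax i hi
    rw [hk0, norm_zero] at this
    linarith
  have := (PadicAlgCl.isNonarchimedean p).apply_sum_eq_of_lt (fun a => (norm_neg a).symm)
    (s := T) (l := f) hk (fun j hj hjk => by
      refine lt_of_le_of_ne (hmax j hj) fun he => hjk ?_
      refine hinj j hj k hk (fun h0 => hk0 ?_) hk0 he
      rw [h0, norm_zero] at he
      exact norm_eq_zero.1 he.symm)
  exact (hmax i hi).trans (this ▸ h)

/-- Averaging over the `N`-th roots of unity, with `p ∤ N`, splits an integral expression into
integral parts according to the residue of the exponent modulo `N`. -/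
theorem sum_filter_mod_mem_unitBall {N : ℕ} (hN : ¬ p ∣ N) (hN0 : 0 < N) {ζ : PadicAlgCl p}
    (hζ : IsPrimitiveRoot ζ N) (n : ℕ) (c : ℕ → PadicAlgCl p) (t : PadicAlgCl p)
    (h : ∀ k, ∑ i ∈ Finset.range n, c i * (ζ ^ k * t) ^ i ∈ unitBall p) {r : ℕ} (hr : r < N) :
    ∑ i ∈ Finset.range n with i % N = r, c i * t ^ i ∈ unitBall p := by
  have hζ1 : ζ ∈ unitBall p := by
    rw [mem_unitBall, ← pow_le_one_iff_of_nonneg (norm_nonneg _) hN0.ne', ← norm_pow,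
      hζ.pow_eq_one, norm_one]
  have hgeom : ∀ i, ∑ k ∈ Finset.range N, (ζ ^ (N - r + i)) ^ k
      = if i % N = r then (N : PadicAlgCl p) else 0 := by
    intro i
    have hiff : N ∣ N - r + i ↔ i % N = r := by
      constructor
      · rintro ⟨w, hw⟩
        have : i = r + N * (w - 1) := by
          rcases w with _ | w
          · simp at hw; omega
          · rw [Nat.add_sub_cancel, Nat.mul_succ] at *; omega
        rw [this, Nat.add_mul_mod_self_left, Nat.mod_eq_of_lt hr]
      · intro hi
        refine ⟨1 + i / N, ?_⟩
        have := Nat.mod_add_div i N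
        rw [Nat.mul_add]; omega
    split_ifs with hi
    · rw [hζ.pow_eq_one_iff_dvd _ |>.2 (hiff.2 hi)]
      simp
    · have hne : ζ ^ (N - r + i) ≠ 1 := fun h1 =>
        hi (hiff.1 ((hζ.pow_eq_one_iff_dvd _).1 h1))
      have := mul_geom_sum (ζ ^ (N - r + i)) N
      rw [pow_right_comm ζ, hζ.pow_eq_one, one_pow, sub_self] at this
      exact (mul_eq_zero.1 this).resolve_left (sub_ne_zero.2 hne)
  -- `ζ ^ (N - r)` stands for `ζ ^ (-r)`
  have key : ∑ k ∈ Finset.range N, ζ ^ ((N - r) * k) *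
      ∑ i ∈ Finset.range n, c i * (ζ ^ k * t) ^ i
      = N * ∑ i ∈ Finset.range n with i % N = r, c i * t ^ i := by
    simp_rw [Finset.mul_sum]
    rw [Finset.sum_comm, Finset.sum_filter]
    refine Finset.sum_congr rfl fun i _ => ?_
    have := hgeom i
    calc _ = c i * t ^ i * ∑ k ∈ Finset.range N, (ζ ^ (N - r + i)) ^ k := by
          rw [Finset.mul_sum]
          refine Finset.sum_congr rfl fun k _ => ?_
          ring
      _ = _ := by rw [this]; split_ifs <;> ring
  have hmem := Subring.sum_mem (unitBall p) (t := Finset.range N)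
    (f := fun k => ζ ^ ((N - r) * k) * ∑ i ∈ Finset.range n, c i * (ζ ^ k * t) ^ i)
    fun k _ => mul_mem (pow_mem hζ1 _) (h k)
  rw [key, mem_unitBall, norm_mul, norm_natCast_eq_one hN, one_mul] at hmem
  exact hmem

theorem norm_ratCast_mul_pow {t : PadicAlgCl p} {e v : ℕ}
    (ht : ‖t‖ ^ e = (p : ℝ) ^ (-(v : ℤ))) {q : ℚ} (hq : q ≠ 0) (i : ℕ) :
    ‖(q : PadicAlgCl p) * t ^ i‖ ^ e = (p : ℝ) ^ (-(e * padicValRat p q + i * v)) := by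
  have hp : (p : ℝ) ≠ 0 := by exact_mod_cast (Fact.out : p.Prime).ne_zero
  rw [norm_mul, norm_pow, mul_pow, norm_ratCast_eq_zpow hq, ← pow_mul, mul_comm i, pow_mul, ht,
    ← zpow_natCast, ← zpow_natCast, ← zpow_mul, ← zpow_mul, ← zpow_add₀ hp]
  congr 1
  ring

/-- If `t` has valuation `v / e`, and the exponents `i` occurring in a sum `∑ cᵢ tⁱ` with rational
coefficients are such that the numbers `i v / e` are distinct modulo `1`, then the terms have
distinct valuations, so that integrality of the sum bounds every coefficient. -/
theorem mul_pow_mem_of_sum_mem_unitBall {t : PadicAlgCl p} {e v : ℕ} (he : 0 < e)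
    (ht : ‖t‖ ^ e = (p : ℝ) ^ (-(v : ℤ))) (T : Finset ℕ)
    (hsep : ∀ i ∈ T, ∀ j ∈ T, (e : ℤ) ∣ ((i : ℤ) - j) * v → i = j) (c : ℕ → ℚ)
    (h : ∑ i ∈ T, (c i : PadicAlgCl p) * t ^ i ∈ unitBall p) :
    ∀ i ∈ T, c i * (p : ℚ) ^ (i * v / e) ∈ localizedIntegers p := by
  have hp1 : (1 : ℝ) < p := by exact_mod_cast (Fact.out : p.Prime).one_lt
  have hp : (p : ℝ) ≠ 0 := by positivity
  have hpq : (p : ℚ) ≠ 0 := by exact_mod_cast (Fact.out : p.Prime).ne_zero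
  intro i hi
  by_cases hc : c i = 0
  · rw [hc, zero_mul]; exact zero_mem _
  have h1 := norm_le_one_of_norm_sum_le_one T (fun i => (c i : PadicAlgCl p) * t ^ i)
    (fun i hi j hj hi0 hj0 hij => by
      have hi0 : c i ≠ 0 := by rintro h0; simp [h0] at hi0
      have hj0 : c j ≠ 0 := by rintro h0; simp [h0] at hj0
      have hij' := congrArg (· ^ e) hij
      simp only [norm_ratCast_mul_pow ht hi0, norm_ratCast_mul_pow ht hj0] at hij'
      have := zpow_right_injective₀ (by positivity) hp1.ne' hij'
      refine hsep i hi j hj ⟨padicValRat p (c j) - padicValRat p (c i), ?_⟩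
      linarith) h i hi
  have h2 := pow_le_one₀ (n := e) (norm_nonneg _) h1
  rw [norm_ratCast_mul_pow ht hc, ← zpow_zero (p : ℝ), zpow_le_zpow_iff_right₀ hp1] at h2
  rw [← norm_ratCast_le_one_iff, norm_ratCast_eq_zpow (mul_ne_zero hc (pow_ne_zero _ hpq)),
    padicValRat.mul hc (pow_ne_zero _ hpq), padicValRat.pow,
    padicValRat.self (Fact.out : p.Prime).one_lt, ← zpow_zero (p : ℝ),
    zpow_le_zpow_iff_right₀ hp1]
  have h3 : -padicValRat p (c i) ≤ ((i * v / e : ℕ) : ℤ) := by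
    push_cast
    rw [Int.le_ediv_iff_mul_le (by exact_mod_cast he)]
    linarith
  linarith

/-- A root of an Eisenstein polynomial of degree `e` has valuation `1 / e`. -/
theorem norm_pow_eq_of_eisenstein {x u y : PadicAlgCl p} {e : ℕ} (he : e ≠ 0) (hx : x ∈ unitBall p)
    (hu : ‖u‖ = 1) (hy : y ∈ unitBall p) (h : x ^ e = p * (u + x * y)) :
    ‖x‖ ^ e = (p : ℝ) ^ (-((1 : ℕ) : ℤ)) := by
  have hp1 : (p : ℝ)⁻¹ < 1 := inv_lt_one_of_one_lt₀ (by exact_mod_cast (Fact.out : p.Prime).one_lt)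
  have hlt : ‖x‖ < 1 := by
    rw [← pow_lt_one_iff_of_nonneg (norm_nonneg _) he, ← norm_pow, h, norm_mul, norm_p_padicAlgCl]
    have hs : ‖u + x * y‖ ≤ 1 := mem_unitBall.1 (add_mem (mem_unitBall.2 hu.le) (mul_mem hx hy))
    have : 0 ≤ (p : ℝ)⁻¹ := by positivity
    nlinarith [norm_nonneg (u + x * y)]
  have hxy : ‖x * y‖ < ‖u‖ := by
    rw [norm_mul, hu]
    have := mem_unitBall.1 hy
    nlinarith [norm_nonneg x, norm_nonneg y]
  have := IsUltrametricDist.norm_add_eq_max_of_norm_ne_norm hxy.ne'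
  rw [← norm_pow, h, norm_mul, this, max_eq_left hxy.le, hu, norm_p_padicAlgCl]
  simp

end Norm

/-! ### Integral elements of pure cubic and quartic extensions -/

section Integrality

theorem isIntegral_of_quartic {F : Type*} [CommRing F] {x : F} (a b c d : ℤ)
    (h : x ^ 4 + a * x ^ 3 + b * x ^ 2 + c * x + d = 0) : IsIntegral ℤ x := by
  refine ⟨Polynomial.X ^ 4 + Polynomial.C a * Polynomial.X ^ 3 + Polynomial.C b * Polynomial.X ^ 2
    + Polynomial.C c * Polynomial.X + Polynomial.C d, by monicity!, ?_⟩
  simp only [Polynomial.eval₂_add, Polynomial.eval₂_mul, Polynomial.eval₂_pow, Polynomial.eval₂_X,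
    Polynomial.eval₂_C]
  simpa using h

variable {F : Type*} [Field F] [CharZero F]

/-- With `η` the given element and `9 n = m ^ 2 - 1`, the equation is
`η ^ 3 - η ^ 2 - 3 n η - 3 n ^ 2 = 0`. -/
theorem isIntegral_cubic_generator {m : ℤ} {s : F} (hs : s ^ 3 = m) (hm : m ^ 2 ≡ 1 [ZMOD 9]) :
    IsIntegral ℤ ((s ^ 2 + m * s + 1) / 3) := by
  obtain ⟨n, hn⟩ := hm.symm.dvd
  have hn' : (n : F) = ((s ^ 3) ^ 2 - 1) / 9 := by
    have := congrArg (Int.cast : ℤ → F) hn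
    push_cast at this
    rw [hs]
    linear_combination -this / 9
  -- the cubic equation of the element, multiplied by the element itself
  refine isIntegral_of_quartic (-1) (-3 * n) (-3 * n ^ 2) 0 ?_
  push_cast
  rw [hn', ← hs]
  ring

theorem isIntegral_quadratic_generator {m : ℤ} {s : F} (hs : s ^ 4 = m) (hm : m ≡ 1 [ZMOD 4]) :
    IsIntegral ℤ ((s ^ 2 - 1) / 2) := by
  obtain ⟨n, hn⟩ := hm.symm.dvd
  have hn' : (m : F) = 4 * n + 1 := by
    have := congrArg (Int.cast : ℤ → F) hn
    push_cast at this
    linear_combination this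
  -- the quadratic equation `δ ^ 2 + δ - n = 0`, multiplied by `δ ^ 2`
  refine isIntegral_of_quartic 1 (-n) 0 0 ?_
  push_cast
  linear_combination ((s ^ 2 - 1) / 2) ^ 2 / 4 * (hs + hn')

/-- With `γ` the given element, `γ (s - 1) = (m - 1) / 4`; substituting this in `s ^ 4 = m` gives the
equation of `γ`. -/
theorem isIntegral_quartic_generator {m : ℤ} {s : F} (hs : s ^ 4 = m) (hm : m ≡ 1 [ZMOD 8]) :
    IsIntegral ℤ ((s ^ 3 + s ^ 2 + s + 1) / 4) := by
  obtain ⟨n, hn⟩ := hm.symm.dvd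
  have hn' : (n : F) = (s ^ 4 - 1) / 8 := by
    have := congrArg (Int.cast : ℤ → F) hn
    push_cast at this
    rw [hs]
    linear_combination -this / 8
  refine isIntegral_of_quartic (-1) (-3 * n) (-4 * n ^ 2) (-2 * n ^ 3) ?_
  push_cast
  rw [hn']
  ring

end Integrality

section Local

variable {p : ℕ} [Fact p.Prime]

theorem mem_unitBall_of_isIntegral_int {x : PadicAlgCl p} (hx : IsIntegral ℤ x) :
    x ∈ unitBall p :=
  mem_unitBall_of_isIntegral hx.tower_top

theorem mem_unitBall_of_mul_mem {x y : PadicAlgCl p} (hx : ‖x‖ = 1) (h : x * y ∈ unitBall p) :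
    y ∈ unitBall p := by
  rwa [mem_unitBall, norm_mul, hx, one_mul] at h

theorem norm_eq_one_of_pow_eq_intCast {s : PadicAlgCl p} {n : ℕ} (hn : n ≠ 0) {m : ℤ}
    (hm : ¬ (p : ℤ) ∣ m) (hs : s ^ n = m) : ‖s‖ = 1 := by
  rw [← pow_eq_one_iff_of_nonneg (norm_nonneg _) hn, ← norm_pow, hs, norm_intCast_eq_one hm]

theorem mem_localizedIntegers_of_mul_mem {s : ℤ} (hs : ¬ (p : ℤ) ∣ s) {q : ℚ}
    (h : s * q ∈ localizedIntegers p) : q ∈ localizedIntegers p := by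
  rw [← ratCast_mem_unitBall] at h ⊢
  push_cast at h
  exact mem_unitBall_of_mul_mem (norm_intCast_eq_one hs) h

theorem mem_localizedIntegers_iff_padicValRat {q : ℚ} (hq : q ≠ 0) :
    q ∈ localizedIntegers p ↔ 0 ≤ padicValRat p q := by
  have hp1 : (1 : ℝ) < p := by exact_mod_cast (Fact.out : p.Prime).one_lt
  rw [← norm_ratCast_le_one_iff, norm_ratCast_eq_zpow hq, ← zpow_zero (p : ℝ),
    zpow_le_zpow_iff_right₀ hp1, neg_nonpos]

/-- The valuation of `p q²` is odd, so it is nonnegative only if that of `q` is. -/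
theorem mem_localizedIntegers_of_p_mul_sq_mem {q : ℚ} (h : p * q ^ 2 ∈ localizedIntegers p) :
    q ∈ localizedIntegers p := by
  by_cases hq : q = 0
  · rw [hq]; exact zero_mem _
  have hpq : (p : ℚ) ≠ 0 := by exact_mod_cast (Fact.out : p.Prime).ne_zero
  rw [mem_localizedIntegers_iff_padicValRat (mul_ne_zero hpq (pow_ne_zero _ hq)),
    padicValRat.mul hpq (pow_ne_zero _ hq), padicValRat.pow,
    padicValRat.self (Fact.out : p.Prime).one_lt] at h
  rw [mem_localizedIntegers_iff_padicValRat hq]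
  push_cast at h
  omega

theorem mem_localizedIntegers_of_sq_mem {q : ℚ} (h : q ^ 2 ∈ localizedIntegers p) :
    q ∈ localizedIntegers p := by
  rw [← ratCast_mem_unitBall, mem_unitBall] at h ⊢
  push_cast at h
  rwa [norm_pow, pow_le_one_iff_of_nonneg (norm_nonneg _) two_ne_zero] at h

theorem inv_mem_localizedIntegers_of_notMem {q : ℚ} (h : q ∉ localizedIntegers p) :
    (p * q)⁻¹ ∈ localizedIntegers p := by
  have hq : q ≠ 0 := by rintro rfl; exact h (zero_mem _)
  have hpq : (p : ℚ) ≠ 0 := by exact_mod_cast (Fact.out : p.Prime).ne_zero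
  rw [mem_localizedIntegers_iff_padicValRat hq] at h
  rw [mem_localizedIntegers_iff_padicValRat (inv_ne_zero (mul_ne_zero hpq hq)), padicValRat.inv,
    padicValRat.mul hpq hq, padicValRat.self (Fact.out : p.Prime).one_lt]
  omega

theorem intCast_div_pow_mem_localizedIntegers {a : ℤ} {k : ℕ} :
    (a / p ^ k : ℚ) ∈ localizedIntegers p ↔ (p : ℤ) ^ k ∣ a := by
  by_cases ha : a = 0
  · simp [ha, zero_mem]
  have hpq : (p : ℚ) ≠ 0 := by exact_mod_cast (Fact.out : p.Prime).ne_zero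
  have haq : (a : ℚ) ≠ 0 := by exact_mod_cast ha
  rw [mem_localizedIntegers_iff_padicValRat (div_ne_zero haq (pow_ne_zero _ hpq)),
    padicValRat.div haq (pow_ne_zero _ hpq), padicValRat.pow,
    padicValRat.self (Fact.out : p.Prime).one_lt, padicValRat.of_int, padicValInt_dvd_iff]
  simp [ha]

/-- Finitely many elements of `ℤ_(p)` have a common denominator prime to `p`. -/
theorem exists_intCast_eq_mul {ι : Type*} [Fintype ι] (q : ι → ℚ)
    (hq : ∀ i, q i ∈ localizedIntegers p) :
    ∃ s : ℤ, ¬ (p : ℤ) ∣ s ∧ ∃ a : ι → ℤ, ∀ i, s * q i = a i := by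
  classical
  refine ⟨∏ i, ((q i).den : ℤ), ?_, fun i => (∏ j ∈ Finset.univ.erase i, ((q j).den : ℤ)) *
    (q i).num, fun i => ?_⟩
  · have hp : Prime (p : ℤ) := Nat.prime_iff_prime_int.1 Fact.out
    rw [hp.dvd_finsetProd_iff]
    rintro ⟨i, -, hi⟩
    exact (Nat.Prime.coprime_iff_not_dvd Fact.out).1 (hq i) (by exact_mod_cast hi)
  · rw [← Finset.mul_prod_erase _ _ (Finset.mem_univ i)]
    push_cast
    have := Rat.mul_den_eq_num (q i)
    linear_combination (∏ j ∈ Finset.univ.erase i, ((q j).den : ℚ)) * this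

end Local

/-! ### Pure cubic fields at `3` -/

section Cubic

local instance : Fact (Nat.Prime 3) := ⟨Nat.prime_three⟩

/-- Here `s - m` is a root of an Eisenstein polynomial, so `1, s, s ^ 2` span the integral elements
at `3`. -/
theorem cubic_coeff_mem_of_not_modEq {m : ℤ} (hm : ¬ (3 : ℤ) ∣ m) (hm9 : ¬ m ^ 2 ≡ 1 [ZMOD 9])
    {c₀ c₁ c₂ : ℚ}
    (H : ∀ s : PadicAlgCl 3, s ^ 3 = m → (c₀ : PadicAlgCl 3) + c₁ * s + c₂ * s ^ 2 ∈ unitBall 3) :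
    c₀ ∈ localizedIntegers 3 ∧ c₁ ∈ localizedIntegers 3 ∧ c₂ ∈ localizedIntegers 3 := by
  obtain ⟨s, hs⟩ := IsAlgClosed.exists_pow_nat_eq (m : PadicAlgCl 3) (n := 3) (by norm_num)
  have h3 : (3 : ℤ) ∣ m ^ 2 - 1 := by
    have : m % 3 = 1 ∨ m % 3 = 2 := by omega
    apply Int.dvd_of_emod_eq_zero
    rcases this with h | h <;> simp [pow_two, Int.sub_emod, Int.mul_emod, h]
  obtain ⟨n, hn⟩ := h3
  have hn3 : ¬ (3 : ℤ) ∣ n := by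
    rintro ⟨k, rfl⟩
    exact hm9 (Int.modEq_iff_dvd.2 ⟨-k, by linarith⟩)
  have hn' : (m : PadicAlgCl 3) ^ 2 = 3 * n + 1 := by
    have := congrArg (Int.cast : ℤ → PadicAlgCl 3) hn
    push_cast at this
    linear_combination this
  have hmO : (m : PadicAlgCl 3) ∈ unitBall 3 := norm_intCast_le_one m
  have hsO : s ∈ unitBall 3 := (norm_eq_one_of_pow_eq_intCast (by norm_num) hm hs).le
  have hπ := norm_pow_eq_of_eisenstein (p := 3) (x := s - m) (u := -(m * n : ℤ))
    (y := -(m * (s - m) + m ^ 2)) (e := 3) (by norm_num) (sub_mem hsO hmO)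
    (by rw [norm_neg]; exact norm_intCast_eq_one (Int.prime_three.not_dvd_mul hm hn3))
    (neg_mem (add_mem (mul_mem hmO (sub_mem hsO hmO)) (pow_mem hmO 2)))
    (by push_cast; linear_combination hs - m * hn')
  have hsum := mul_pow_mem_of_sum_mem_unitBall (by norm_num) hπ (Finset.range 3)
    (by
      intro i hi j hj hij
      simp only [Finset.mem_range] at hi hj
      push_cast at hij
      omega)
    -- the coefficients of the expansion in powers of `s - m`
    (fun i => if i = 0 then c₀ + c₁ * m + c₂ * m ^ 2 else if i = 1 then c₁ + 2 * m * c₂ else c₂)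
    (by
      have := H s hs
      convert this using 1
      simp [Finset.sum_range_succ]
      ring)
  have h0 := hsum 0 (by simp)
  have h1 := hsum 1 (by simp)
  have h2 := hsum 2 (by simp)
  norm_num at h0 h1 h2
  have hmR : (m : ℚ) ∈ localizedIntegers 3 := intCast_mem _ m
  have h2R : (2 : ℚ) ∈ localizedIntegers 3 := by exact_mod_cast natCast_mem (localizedIntegers 3) 2
  have h1' : c₁ ∈ localizedIntegers 3 := by
    convert sub_mem h1 (mul_mem (mul_mem h2R hmR) h2) using 1
    ring
  refine ⟨?_, h1', h2⟩
  convert sub_mem (sub_mem h0 (mul_mem h1' hmR)) (mul_mem h2 (pow_mem hmR 2)) using 1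
  ring

/-- The conclusion says that `c₀ + c₁ s + c₂ s ^ 2` is a `ℤ_(3)`-combination of `1`, `s` and
`(s ^ 2 + m s + 1) / 3`. -/
theorem cubic_coeff_mem_of_modEq {m : ℤ} (hm : ¬ (3 : ℤ) ∣ m) (hm9 : m ^ 2 ≡ 1 [ZMOD 9])
    {c₀ c₁ c₂ : ℚ}
    (H : ∀ s : PadicAlgCl 3, s ^ 3 = m → (c₀ : PadicAlgCl 3) + c₁ * s + c₂ * s ^ 2 ∈ unitBall 3) :
    c₀ - c₂ ∈ localizedIntegers 3 ∧ c₁ - m * c₂ ∈ localizedIntegers 3 ∧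
      3 * c₂ ∈ localizedIntegers 3 := by
  obtain ⟨s, hs⟩ := IsAlgClosed.exists_pow_nat_eq (m : PadicAlgCl 3) (n := 3) (by norm_num)
  obtain ⟨ω, hω⟩ := IsAlgClosed.exists_root (k := PadicAlgCl 3)
    (Polynomial.X ^ 2 + Polynomial.X + 1) (by
      have : (Polynomial.X ^ 2 + Polynomial.X + 1 : Polynomial (PadicAlgCl 3)).degree = 2 := by
        compute_degree!
      rw [this]; norm_num)
  have hω : ω ^ 2 + ω + 1 = 0 := by simpa using hω
  have hω3 : ω ^ 3 = 1 := by linear_combination (ω - 1) * hω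
  have hs1 : ‖s‖ = 1 := norm_eq_one_of_pow_eq_intCast (by norm_num) hm hs
  have hω1 : ω ∈ unitBall 3 :=
    (norm_eq_one_of_pow_eq_intCast (m := 1) (n := 3) (by norm_num) (by norm_num)
      (by simpa using hω3)).le
  have hs' : (ω * s) ^ 3 = m := by rw [mul_pow, hω3, one_mul, hs]
  have hs'' : (ω ^ 2 * s) ^ 3 = m := by rw [mul_pow, pow_right_comm, hω3, one_pow, one_mul, hs]
  have hc₂ : 3 * c₂ ∈ localizedIntegers 3 := by
    rw [← ratCast_mem_unitBall]
    refine mem_unitBall_of_mul_mem (x := s ^ 2) (by rw [norm_pow, hs1, one_pow]) ?_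
    convert add_mem (H s hs) (add_mem (mul_mem hω1 (H _ hs')) (mul_mem (pow_mem hω1 2) (H _ hs'')))
      using 1
    push_cast
    linear_combination (-c₀ - c₁ * s * (ω ^ 2 - ω + 1) - c₂ * s ^ 2 * (ω ^ 4 - ω ^ 3 + 2 * ω - 2)) * hω
  -- subtracting `3 c₂ (s ^ 2 + m s + 1) / 3` leaves `b₀ + b₁ s`
  have hG : ∀ t : PadicAlgCl 3, t ^ 3 = m →
      ((c₀ - c₂ : ℚ) : PadicAlgCl 3) + (c₁ - m * c₂ : ℚ) * t ∈ unitBall 3 := by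
    intro t ht
    convert sub_mem (H t ht) (mul_mem (ratCast_mem_unitBall.2 hc₂)
      (mem_unitBall_of_isIntegral_int (isIntegral_cubic_generator ht hm9))) using 1
    push_cast
    ring
  generalize c₀ - c₂ = b₀ at hG ⊢
  generalize c₁ - m * c₂ = b₁ at hG ⊢
  have hb₀ : b₀ ∈ localizedIntegers 3 := by
    -- the second elementary symmetric function of the conjugates of `b₀ + b₁ s` is `3 b₀ ^ 2`
    apply mem_localizedIntegers_of_p_mul_sq_mem
    rw [← ratCast_mem_unitBall]
    convert add_mem (mul_mem (hG _ hs) (hG _ hs'))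
      (add_mem (mul_mem (hG _ hs) (hG _ hs'')) (mul_mem (hG _ hs') (hG _ hs''))) using 1
    push_cast
    linear_combination (-2 * b₀ * b₁ * s - b₁ ^ 2 * s ^ 2 * ω) * hω
  refine ⟨hb₀, ?_, hc₂⟩
  rw [← ratCast_mem_unitBall]
  refine mem_unitBall_of_mul_mem hs1 ?_
  convert sub_mem (hG s hs) (ratCast_mem_unitBall.2 hb₀) using 1
  ring

end Cubic

/-! ### Pure quartic fields at `2` -/

section Quartic

local instance : Fact (Nat.Prime 2) := ⟨Nat.prime_two⟩

/-- Here `s - 1` is a root of an Eisenstein polynomial, so the powers of `s` span the integral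
elements at `2`. -/
theorem quartic_coeff_mem_of_modEq_three {m : ℤ} (hm : m ≡ 3 [ZMOD 4])
    {c₀ c₁ c₂ c₃ : ℚ}
    (H : ∀ s : PadicAlgCl 2, s ^ 4 = m →
      (c₀ : PadicAlgCl 2) + c₁ * s + c₂ * s ^ 2 + c₃ * s ^ 3 ∈ unitBall 2) :
    c₀ ∈ localizedIntegers 2 ∧ c₁ ∈ localizedIntegers 2 ∧ c₂ ∈ localizedIntegers 2 ∧
      c₃ ∈ localizedIntegers 2 := by
  obtain ⟨s, hs⟩ := IsAlgClosed.exists_pow_nat_eq (m : PadicAlgCl 2) (n := 4) (by norm_num)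
  obtain ⟨n, hn⟩ := hm.symm.dvd
  have hm2 : ¬ (2 : ℤ) ∣ m := by omega
  have hn' : (m : PadicAlgCl 2) = 4 * n + 3 := by
    have := congrArg (Int.cast : ℤ → PadicAlgCl 2) hn
    push_cast at this
    linear_combination this
  have h2O : (2 : PadicAlgCl 2) ∈ unitBall 2 := by exact_mod_cast natCast_mem (unitBall 2) 2
  have h3O : (3 : PadicAlgCl 2) ∈ unitBall 2 := by exact_mod_cast natCast_mem (unitBall 2) 3
  have hsO : s ∈ unitBall 2 := (norm_eq_one_of_pow_eq_intCast (by norm_num) hm2 hs).le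
  have hπO : s - 1 ∈ unitBall 2 := sub_mem hsO (one_mem _)
  have hπ := norm_pow_eq_of_eisenstein (p := 2) (x := s - 1) (u := (2 * n + 1 : ℤ))
    (y := -(2 * (s - 1) ^ 2 + 3 * (s - 1) + 2)) (e := 4) (by norm_num) hπO
    (norm_intCast_eq_one (by push_cast; omega))
    (neg_mem (add_mem (add_mem (mul_mem h2O (pow_mem hπO 2)) (mul_mem h3O hπO)) h2O))
    (by push_cast; linear_combination hs + hn')
  have hsum := mul_pow_mem_of_sum_mem_unitBall (by norm_num) hπ (Finset.range 4)
    (by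
      intro i hi j hj hij
      simp only [Finset.mem_range] at hi hj
      push_cast at hij
      omega)
    -- the coefficients of the expansion in powers of `s - 1`
    (fun i => if i = 0 then c₀ + c₁ + c₂ + c₃ else if i = 1 then c₁ + 2 * c₂ + 3 * c₃ else
      if i = 2 then c₂ + 3 * c₃ else c₃)
    (by
      have := H s hs
      convert this using 1
      simp [Finset.sum_range_succ]
      ring)
  have h0 := hsum 0 (by simp)
  have h1 := hsum 1 (by simp)
  have h2 := hsum 2 (by simp)
  have h3 := hsum 3 (by simp)
  norm_num at h0 h1 h2 h3
  have h2R : (2 : ℚ) ∈ localizedIntegers 2 := by exact_mod_cast natCast_mem (localizedIntegers 2) 2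
  have h3R : (3 : ℚ) ∈ localizedIntegers 2 := by exact_mod_cast natCast_mem (localizedIntegers 2) 3
  have h2' : c₂ ∈ localizedIntegers 2 := by
    convert sub_mem h2 (mul_mem h3R h3) using 1
    ring
  have h1' : c₁ ∈ localizedIntegers 2 := by
    convert sub_mem h1 (add_mem (mul_mem h2R h2') (mul_mem h3R h3)) using 1
    ring
  refine ⟨?_, h1', h2', h3⟩
  convert sub_mem h0 (add_mem (add_mem h1' h2') h3) using 1
  ring

/-- The four traces `∑ σ(s⁻ʲ x)`, over the conjugates of `x = ∑ cⱼ sʲ`, are the numbers `4 cⱼ`. -/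
theorem quartic_four_mul_coeff_mem {m : ℤ} (hm : ¬ (2 : ℤ) ∣ m) {c₀ c₁ c₂ c₃ : ℚ}
    (H : ∀ s : PadicAlgCl 2, s ^ 4 = m →
      (c₀ : PadicAlgCl 2) + c₁ * s + c₂ * s ^ 2 + c₃ * s ^ 3 ∈ unitBall 2) :
    4 * c₀ ∈ localizedIntegers 2 ∧ 4 * c₁ ∈ localizedIntegers 2 ∧ 4 * c₂ ∈ localizedIntegers 2 ∧
      4 * c₃ ∈ localizedIntegers 2 := by
  obtain ⟨s, hs⟩ := IsAlgClosed.exists_pow_nat_eq (m : PadicAlgCl 2) (n := 4) (by norm_num)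
  obtain ⟨i, hi⟩ := IsAlgClosed.exists_pow_nat_eq (-1 : PadicAlgCl 2) (n := 2) (by norm_num)
  have hs1 : ‖s‖ = 1 := norm_eq_one_of_pow_eq_intCast (by norm_num) hm hs
  have hi1 : i ∈ unitBall 2 :=
    (norm_eq_one_of_pow_eq_intCast (m := -1) (n := 2) (by norm_num) (by norm_num)
      (by simpa using hi)).le
  have H0 := H s hs
  have H1 := H (i * s) (by linear_combination i ^ 4 * hs + m * (i ^ 2 - 1) * hi)
  have H2 := H (-s) (by linear_combination hs)
  have H3 := H (-(i * s)) (by linear_combination i ^ 4 * hs + m * (i ^ 2 - 1) * hi)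
  simp only [← ratCast_mem_unitBall]
  refine ⟨?_, ?_, ?_, ?_⟩
  · convert add_mem (add_mem H0 H2) (add_mem H1 H3) using 1
    push_cast
    linear_combination (-2 * c₂ * s ^ 2) * hi
  · refine mem_unitBall_of_mul_mem hs1 ?_
    convert sub_mem (sub_mem H0 H2) (mul_mem hi1 (sub_mem H1 H3)) using 1
    push_cast
    linear_combination (2 * c₁ * s + 2 * c₃ * s ^ 3 * (i ^ 2 - 1)) * hi
  · refine mem_unitBall_of_mul_mem (x := s ^ 2) (by rw [norm_pow, hs1, one_pow]) ?_
    convert sub_mem (add_mem H0 H2) (add_mem H1 H3) using 1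
    push_cast
    linear_combination (2 * c₂ * s ^ 2) * hi
  · refine mem_unitBall_of_mul_mem (x := s ^ 3) (by rw [norm_pow, hs1, one_pow]) ?_
    convert add_mem (sub_mem H0 H2) (mul_mem hi1 (sub_mem H1 H3)) using 1
    push_cast
    linear_combination (-2 * c₁ * s - 2 * c₃ * s ^ 3 * (i ^ 2 - 1)) * hi

/-- The conclusion says that `∑ cⱼ sʲ` is a `ℤ_(2)`-combination of `1`, `s`, `(s ^ 2 - 1) / 2` and
`(s ^ 3 + s ^ 2 + s + 1) / 4`. -/
theorem quartic_coeff_mem_of_modEq_one {m : ℤ} (hm : m ≡ 1 [ZMOD 8])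
    {c₀ c₁ c₂ c₃ : ℚ}
    (H : ∀ s : PadicAlgCl 2, s ^ 4 = m →
      (c₀ : PadicAlgCl 2) + c₁ * s + c₂ * s ^ 2 + c₃ * s ^ 3 ∈ unitBall 2) :
    c₀ + c₂ - 2 * c₃ ∈ localizedIntegers 2 ∧ c₁ - c₃ ∈ localizedIntegers 2 ∧
      2 * (c₂ - c₃) ∈ localizedIntegers 2 ∧ 4 * c₃ ∈ localizedIntegers 2 := by
  have hm2 : ¬ (2 : ℤ) ∣ m := by
    have := hm.symm.dvd
    omega
  have hm4 : m ≡ 1 [ZMOD 4] := hm.of_mul_left 2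
  have hc₃ := (quartic_four_mul_coeff_mem hm2 H).2.2.2
  obtain ⟨s, hs⟩ := IsAlgClosed.exists_pow_nat_eq (m : PadicAlgCl 2) (n := 4) (by norm_num)
  obtain ⟨i, hi⟩ := IsAlgClosed.exists_pow_nat_eq (-1 : PadicAlgCl 2) (n := 2) (by norm_num)
  have hs1 : ‖s‖ = 1 := norm_eq_one_of_pow_eq_intCast (by norm_num) hm2 hs
  have hs' : (-s) ^ 4 = m := by linear_combination hs
  have his : (i * s) ^ 4 = m := by linear_combination i ^ 4 * hs + m * (i ^ 2 - 1) * hi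
  have his' : (-(i * s)) ^ 4 = m := by linear_combination his
  have hs2 : ‖s ^ 2‖ = 1 := by rw [norm_pow, hs1, one_pow]
  have h2R : (2 : ℚ) ∈ localizedIntegers 2 := by exact_mod_cast natCast_mem (localizedIntegers 2) 2
  -- subtracting `4 c₃ (s ^ 3 + s ^ 2 + s + 1) / 4` leaves `b₀ + b₁ s + b₂ s ^ 2`
  have hG : ∀ t : PadicAlgCl 2, t ^ 4 = m → ((c₀ - c₃ : ℚ) : PadicAlgCl 2) + (c₁ - c₃ : ℚ) * t
      + (c₂ - c₃ : ℚ) * t ^ 2 ∈ unitBall 2 := by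
    intro t ht
    convert sub_mem (H t ht) (mul_mem (ratCast_mem_unitBall.2 hc₃)
      (mem_unitBall_of_isIntegral_int (isIntegral_quartic_generator ht hm))) using 1
    push_cast
    ring
  rw [show c₀ + c₂ - 2 * c₃ = (c₀ - c₃) + (c₂ - c₃) by ring]
  generalize c₀ - c₃ = b₀ at hG ⊢
  generalize c₁ - c₃ = b₁ at hG ⊢
  generalize c₂ - c₃ = b₂ at hG ⊢
  have hb₁ : 2 * b₁ ∈ localizedIntegers 2 := by
    rw [← ratCast_mem_unitBall]
    refine mem_unitBall_of_mul_mem hs1 ?_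
    convert sub_mem (hG s hs) (hG _ hs') using 1
    push_cast
    ring
  have hb₀₂ : 2 * (2 * b₀) * (2 * b₂) ∈ localizedIntegers 2 := by
    -- relative norms to `ℚ(s ^ 2)` at two conjugates differ by `s ^ 2 (4 b₀ b₂ - 2 b₁ ^ 2)`
    have h : 4 * b₀ * b₂ - 2 * b₁ ^ 2 ∈ localizedIntegers 2 := by
      rw [← ratCast_mem_unitBall]
      refine mem_unitBall_of_mul_mem hs2 ?_
      convert sub_mem (mul_mem (hG s hs) (hG _ hs')) (mul_mem (hG _ his) (hG _ his')) using 1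
      push_cast
      linear_combination (2 * b₀ * b₂ * s ^ 2 - b₁ ^ 2 * s ^ 2
        + b₂ ^ 2 * s ^ 4 * (i ^ 2 - 1)) * hi
    convert add_mem (mul_mem h2R h) (pow_mem hb₁ 2) using 1
    ring
  have hN : (2 * b₀) ^ 2 - m * (2 * b₂) ^ 2 ∈ localizedIntegers 2 := by
    rw [← ratCast_mem_unitBall]
    convert mul_mem (add_mem (hG s hs) (hG _ hs')) (add_mem (hG _ his) (hG _ his')) using 1
    push_cast
    linear_combination (4 * b₂ ^ 2) * hs - (4 * b₀ * b₂ * s ^ 2 + 4 * b₂ ^ 2 * s ^ 4) * hi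
  have hb₂ : 2 * b₂ ∈ localizedIntegers 2 := by
    -- otherwise `hb₀₂` makes `2 b₀` integral, and then `hN` makes `2 b₂` integral
    by_contra hb
    have hinv := inv_mem_localizedIntegers_of_notMem hb
    have hb0 : b₂ ≠ 0 := by
      rintro rfl
      exact hb (by rw [mul_zero]; exact zero_mem _)
    have hb₀ : 2 * b₀ ∈ localizedIntegers 2 := by
      convert mul_mem hb₀₂ hinv using 1
      push_cast
      field_simp
    refine hb (mem_localizedIntegers_of_sq_mem (mem_localizedIntegers_of_mul_mem hm2 ?_))
    convert sub_mem (pow_mem hb₀ 2) hN using 1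
    ring
  -- subtracting `2 b₂ (s ^ 2 - 1) / 2` leaves `(b₀ + b₂) + b₁ s`
  have hF : ∀ t : PadicAlgCl 2, t ^ 4 = m →
      ((b₀ + b₂ : ℚ) : PadicAlgCl 2) + b₁ * t ∈ unitBall 2 := by
    intro t ht
    convert sub_mem (hG t ht) (mul_mem (ratCast_mem_unitBall.2 hb₂)
      (mem_unitBall_of_isIntegral_int (isIntegral_quadratic_generator ht hm4))) using 1
    push_cast
    ring
  have hb₀ : b₀ + b₂ ∈ localizedIntegers 2 := by
    apply mem_localizedIntegers_of_p_mul_sq_mem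
    rw [← ratCast_mem_unitBall]
    convert add_mem (mul_mem (hF s hs) (hF _ hs')) (mul_mem (hF _ his) (hF _ his')) using 1
    push_cast
    linear_combination b₁ ^ 2 * s ^ 2 * hi
  refine ⟨hb₀, ?_, hb₂, hc₃⟩
  rw [← ratCast_mem_unitBall]
  refine mem_unitBall_of_mul_mem hs1 ?_
  convert sub_mem (hF s hs) (ratCast_mem_unitBall.2 hb₀) using 1
  ring

/-- For `aⱼ = 4 cⱼ`, the hypotheses express the integrality of the relative traces and norms of
`∑ cⱼ sʲ` to `ℚ(s ^ 2)`, and the conclusion says that the element lies in the `ℤ_(2)`-span of `1`,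
`s`, `(s ^ 2 - 1) / 2` and `s (s ^ 2 - 1) / 2`. -/
theorem int_congruences_of_modEq_five {m a₀ a₁ a₂ a₃ : ℤ} (hm : m ≡ 5 [ZMOD 8])
    (h₀₂ : 4 ∣ a₀ ^ 2 - m * a₂ ^ 2) (h₁₃ : 4 ∣ a₁ ^ 2 - m * a₃ ^ 2)
    (hS : 8 ∣ a₀ ^ 2 + m * a₂ ^ 2 - 2 * m * a₁ * a₃)
    (hT : 8 ∣ 2 * a₀ * a₂ - a₁ ^ 2 - m * a₃ ^ 2)
    (hST : 256 ∣ (a₀ ^ 2 + m * a₂ ^ 2 - 2 * m * a₁ * a₃) ^ 2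
      - m * (2 * a₀ * a₂ - a₁ ^ 2 - m * a₃ ^ 2) ^ 2) :
    2 ∣ a₂ ∧ 2 ∣ a₃ ∧ 4 ∣ a₀ + a₂ ∧ 4 ∣ a₁ + a₃ := by
  obtain ⟨w, hw⟩ := hm.symm.dvd
  obtain rfl : m = 8 * w + 5 := by linarith
  have hodd : Odd (8 * w + 5) := ⟨4 * w + 2, by ring⟩
  have parity : ∀ x y : ℤ, 4 ∣ x ^ 2 - (8 * w + 5) * y ^ 2 → ∃ z, x = y + 2 * z := by
    intro x y h
    have h2 : Even (x ^ 2 - (8 * w + 5) * y ^ 2) := even_iff_two_dvd.2 (dvd_trans (by norm_num) h)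
    have : Even (x - y) := by
      rw [Int.even_sub, Int.even_pow' two_ne_zero, Int.even_mul, Int.even_pow' two_ne_zero] at h2
      rw [Int.even_sub]
      have := Int.not_even_iff_odd.2 hodd
      tauto
    obtain ⟨z, hz⟩ := this
    exact ⟨z, by linarith⟩
  obtain ⟨b, rfl⟩ := parity _ _ h₀₂
  obtain ⟨d, rfl⟩ := parity _ _ h₁₃
  obtain ⟨σ, hσ⟩ := hS
  obtain ⟨τ, hτ⟩ := hT
  rw [hσ, hτ] at hST
  obtain ⟨f, hf⟩ := parity σ τ (by
    obtain ⟨k, hk⟩ := hST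
    exact ⟨k, by linarith⟩)
  subst hf
  -- dividing `hσ - hτ` by `4`, and `hτ` by `2`, leaves two equations modulo `4`
  have e₁ : b ^ 2 + d ^ 2 + (2 * w + 1) * (a₂ ^ 2 - a₃ ^ 2)
      = 4 * (f + (2 * w + 1) * d * a₃) := by linarith
  have e₂ : a₂ ^ 2 - 3 * a₃ ^ 2 + 2 * (b * a₂ - d * a₃ - d ^ 2) = 4 * (τ + w * a₃ ^ 2) := by
    linarith
  have key : ∀ x y z t w : ZMod 4, z ^ 2 + t ^ 2 + (2 * w + 1) * (x ^ 2 - y ^ 2) = 0 →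
      x ^ 2 - 3 * y ^ 2 + 2 * (z * x - t * y - t ^ 2) = 0 →
      2 * x = 0 ∧ 2 * y = 0 ∧ 2 * x + 2 * z = 0 ∧ 2 * y + 2 * t = 0 := by decide
  have h4 : (4 : ZMod 4) = 0 := rfl
  have := key a₂ a₃ b d w
    (by
      have := congrArg (Int.cast : ℤ → ZMod 4) e₁
      push_cast at this
      rw [this, h4, zero_mul])
    (by
      have := congrArg (Int.cast : ℤ → ZMod 4) e₂
      push_cast at this
      rw [this, h4, zero_mul])
  obtain ⟨k₁, k₂, k₃, k₄⟩ := this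
  have hz : ∀ x : ℤ, (x : ZMod 4) = 0 → (4 : ℤ) ∣ x := fun x hx =>
    (ZMod.intCast_zmod_eq_zero_iff_dvd x 4).1 hx
  have l₁ := hz (2 * a₂) (by push_cast; exact k₁)
  have l₂ := hz (2 * a₃) (by push_cast; exact k₂)
  have l₃ := hz (2 * a₂ + 2 * b) (by push_cast; exact k₃)
  have l₄ := hz (2 * a₃ + 2 * d) (by push_cast; exact k₄)
  omega

/-- The conclusion says that `∑ cⱼ sʲ` is a `ℤ_(2)`-combination of `1`, `s`, `(s ^ 2 - 1) / 2` and
`s (s ^ 2 - 1) / 2`. -/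
theorem quartic_coeff_mem_of_modEq_five {m : ℤ} (hm : m ≡ 5 [ZMOD 8])
    {c₀ c₁ c₂ c₃ : ℚ}
    (H : ∀ s : PadicAlgCl 2, s ^ 4 = m →
      (c₀ : PadicAlgCl 2) + c₁ * s + c₂ * s ^ 2 + c₃ * s ^ 3 ∈ unitBall 2) :
    c₀ + c₂ ∈ localizedIntegers 2 ∧ c₁ + c₃ ∈ localizedIntegers 2 ∧
      2 * c₂ ∈ localizedIntegers 2 ∧ 2 * c₃ ∈ localizedIntegers 2 := by
  have hm2 : ¬ (2 : ℤ) ∣ m := by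
    have := hm.symm.dvd
    omega
  obtain ⟨h0, h1, h2, h3⟩ := quartic_four_mul_coeff_mem hm2 H
  obtain ⟨s, hs⟩ := IsAlgClosed.exists_pow_nat_eq (m : PadicAlgCl 2) (n := 4) (by norm_num)
  obtain ⟨i, hi⟩ := IsAlgClosed.exists_pow_nat_eq (-1 : PadicAlgCl 2) (n := 2) (by norm_num)
  have hs1 : ‖s‖ = 1 := norm_eq_one_of_pow_eq_intCast (by norm_num) hm2 hs
  have hs2 : ‖s ^ 2‖ = 1 := by rw [norm_pow, hs1, one_pow]
  have hi1 : ‖i‖ = 1 :=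
    norm_eq_one_of_pow_eq_intCast (m := -1) (n := 2) (by norm_num) (by norm_num) (by simpa using hi)
  have H0 := H s hs
  have his : (i * s) ^ 4 = m := by linear_combination i ^ 4 * hs + m * (i ^ 2 - 1) * hi
  have H1 := H (i * s) his
  have H2 := H (-s) (by linear_combination hs)
  have H3 := H (-(i * s)) (by linear_combination his)
  have h₀₂ : 4 * (c₀ ^ 2 - m * c₂ ^ 2) ∈ localizedIntegers 2 := by
    rw [← ratCast_mem_unitBall]
    convert mul_mem (add_mem H0 H2) (add_mem H1 H3) using 1
    push_cast
    linear_combination (4 * c₂ ^ 2) * hs - (4 * c₀ * c₂ * s ^ 2 + 4 * c₂ ^ 2 * s ^ 4) * hi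
  have h₁₃ : 4 * (c₁ ^ 2 - m * c₃ ^ 2) ∈ localizedIntegers 2 := by
    rw [← ratCast_mem_unitBall]
    refine mem_unitBall_of_mul_mem (x := i * s ^ 2) (by rw [norm_mul, hi1, hs2, one_mul]) ?_
    convert mul_mem (sub_mem H0 H2) (sub_mem H1 H3) using 1
    push_cast
    linear_combination (4 * i * s ^ 2 * c₃ ^ 2) * hs
      - (4 * c₁ * c₃ * i * s ^ 4 + 4 * c₃ ^ 2 * i * s ^ 6) * hi
  -- the relative norm to `ℚ(t ^ 2)`
  have hu : ∀ t : PadicAlgCl 2, t ^ 4 = m →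
      ((c₀ : PadicAlgCl 2) + c₁ * t + c₂ * t ^ 2 + c₃ * t ^ 3)
        * (c₀ + c₁ * (-t) + c₂ * (-t) ^ 2 + c₃ * (-t) ^ 3)
      = (c₀ ^ 2 + m * c₂ ^ 2 - 2 * m * c₁ * c₃)
        + (2 * c₀ * c₂ - c₁ ^ 2 - m * c₃ ^ 2) * t ^ 2 := by
    intro t ht
    linear_combination (c₂ ^ 2 - 2 * c₁ * c₃ - c₃ ^ 2 * t ^ 2) * ht
  have e₁ := hu s hs
  have e₂ := hu (i * s) his
  have H02 := mul_mem H0 H2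
  have H13 := mul_mem H1 H3
  rw [e₁] at H02
  rw [e₂] at H13
  have hS : 2 * (c₀ ^ 2 + m * c₂ ^ 2 - 2 * m * c₁ * c₃) ∈ localizedIntegers 2 := by
    rw [← ratCast_mem_unitBall]
    convert add_mem H02 H13 using 1
    push_cast
    linear_combination -(2 * c₀ * c₂ - c₁ ^ 2 - m * c₃ ^ 2) * s ^ 2 * hi
  have hT : 2 * (2 * c₀ * c₂ - c₁ ^ 2 - m * c₃ ^ 2) ∈ localizedIntegers 2 := by
    rw [← ratCast_mem_unitBall]
    refine mem_unitBall_of_mul_mem hs2 ?_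
    convert sub_mem H02 H13 using 1
    push_cast
    linear_combination (2 * c₀ * c₂ - c₁ ^ 2 - m * c₃ ^ 2) * s ^ 2 * hi
  have hST : (c₀ ^ 2 + m * c₂ ^ 2 - 2 * m * c₁ * c₃) ^ 2
      - m * (2 * c₀ * c₂ - c₁ ^ 2 - m * c₃ ^ 2) ^ 2 ∈ localizedIntegers 2 := by
    rw [← ratCast_mem_unitBall]
    convert mul_mem H02 H13 using 1
    push_cast
    linear_combination (2 * c₀ * c₂ - c₁ ^ 2 - m * c₃ ^ 2) ^ 2 * hs
      - ((2 * c₀ * c₂ - c₁ ^ 2 - m * c₃ ^ 2) * s ^ 2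
        * (c₀ ^ 2 + m * c₂ ^ 2 - 2 * m * c₁ * c₃)
        + (2 * c₀ * c₂ - c₁ ^ 2 - m * c₃ ^ 2) ^ 2 * s ^ 4) * hi
  obtain ⟨n, hn, a, ha⟩ := exists_intCast_eq_mul (p := 2) ![4 * c₀, 4 * c₁, 4 * c₂, 4 * c₃]
    (by simp [Fin.forall_fin_succ, h0, h1, h2, h3])
  have a0 : (a 0 : ℚ) = n * (4 * c₀) := (ha 0).symm
  have a1 : (a 1 : ℚ) = n * (4 * c₁) := (ha 1).symm
  have a2 : (a 2 : ℚ) = n * (4 * c₂) := (ha 2).symm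
  have a3 : (a 3 : ℚ) = n * (4 * c₃) := (ha 3).symm
  have hnR : (n : ℚ) ∈ localizedIntegers 2 := intCast_mem _ n
  obtain ⟨d2, d3, d0, d1⟩ := int_congruences_of_modEq_five (a₀ := a 0) (a₁ := a 1)
    (a₂ := a 2) (a₃ := a 3) hm
    ((intCast_div_pow_mem_localizedIntegers (p := 2) (k := 2)).1 (by
      convert mul_mem (pow_mem hnR 2) h₀₂ using 1
      push_cast
      rw [a0, a2]
      ring))
    ((intCast_div_pow_mem_localizedIntegers (p := 2) (k := 2)).1 (by
      convert mul_mem (pow_mem hnR 2) h₁₃ using 1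
      push_cast
      rw [a1, a3]
      ring))
    ((intCast_div_pow_mem_localizedIntegers (p := 2) (k := 3)).1 (by
      convert mul_mem (pow_mem hnR 2) hS using 1
      push_cast
      rw [a0, a1, a2, a3]
      ring))
    ((intCast_div_pow_mem_localizedIntegers (p := 2) (k := 3)).1 (by
      convert mul_mem (pow_mem hnR 2) hT using 1
      push_cast
      rw [a0, a1, a2, a3]
      ring))
    ((intCast_div_pow_mem_localizedIntegers (p := 2) (k := 8)).1 (by
      convert mul_mem (pow_mem hnR 4) hST using 1
      push_cast
      rw [a0, a1, a2, a3]
      ring))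
  refine ⟨?_, ?_, ?_, ?_⟩ <;> apply mem_localizedIntegers_of_mul_mem hn
  · convert (intCast_div_pow_mem_localizedIntegers (p := 2) (k := 2)).2 d0 using 1
    push_cast
    rw [a0, a2]
    ring
  · convert (intCast_div_pow_mem_localizedIntegers (p := 2) (k := 2)).2 d1 using 1
    push_cast
    rw [a1, a3]
    ring
  · convert (intCast_div_pow_mem_localizedIntegers (p := 2) (k := 1)).2 d2 using 1
    push_cast
    rw [a2]
    ring
  · convert (intCast_div_pow_mem_localizedIntegers (p := 2) (k := 1)).2 d3 using 1
    push_cast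
    rw [a3]
    ring

end Quartic

/-! ### The valuation of the index -/

section Index

open Module

/-- Integral elements spanning all `ℤ_(p)`-integral elements form a `p`-integral basis as soon as
their number is the degree of the field: they then span the field over `ℚ`. -/
theorem isPIntegralBasis_of_forall_mem_span {K : Type*} [Field K] [CharZero K] {p : ℕ}
    {ι κ : Type*} [Fintype ι] [Fintype κ] (B : Basis κ ℚ K) (hcard : Fintype.card ι = Fintype.card κ)
    (hB : ∀ i, IsIntegral ℤ (B i)) {b : ι → K} (hb : ∀ i, IsIntegral ℤ (b i))
    (hspan : ∀ x : K, IsIntegral (localizedIntegers p) x →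
      x ∈ Submodule.span (localizedIntegers p) (Set.range b)) :
    IsPIntegralBasis p b := by
  have hle : (⊤ : Submodule ℚ K) ≤ Submodule.span ℚ (Set.range b) := by
    rw [← B.span_eq, Submodule.span_le]
    rintro _ ⟨i, rfl⟩
    exact Submodule.span_subset_span (localizedIntegers p) ℚ _ (hspan _ (hB i).tower_top)
  refine ⟨?_, le_antisymm ?_ fun x hx => hspan x hx⟩
  · have := linearIndependent_of_top_le_span_of_card_eq_finrank hle
      (by rw [hcard, finrank_eq_card_basis B])
    refine this.restrict_scalars (R := localizedIntegers p) fun r s hrs => ?_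
    apply Subtype.ext
    simpa [Subring.smul_def] using hrs
  · rw [Submodule.span_le]
    rintro _ ⟨i, rfl⟩
    exact (hb i).tower_top (A := localizedIntegers p)

/-- The index of `ℤ[θ]` as a determinant with respect to an integral basis `ω`. -/
theorem exists_basis_integerIndex_eq_abs_det {K : Type*} [Field K] [NumberField K] {n : ℕ} {θ : K}
    {f : Polynomial ℤ} (hf : f.Monic) (hdeg : f.natDegree = n) (hfθ : Polynomial.aeval θ f = 0)
    (B : Basis (Fin n) ℚ K) (hB : ∀ i, B i = θ ^ (i : ℕ)) :
    ∃ ω : Basis (Fin n) ℚ K, (∀ i, IsIntegral ℤ (ω i)) ∧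
      (∀ x, IsIntegral ℤ x → ∀ i, ∃ a : ℤ, ω.repr x i = a) ∧
      (integerIndex θ : ℚ) = |ω.det B| := by
  have hcard : Fintype.card (Free.ChooseBasisIndex ℤ (NumberField.RingOfIntegers K))
      = Fintype.card (Fin n) := by
    rw [← finrank_eq_card_basis (NumberField.integralBasis K), finrank_eq_card_basis B]
  let e := Fintype.equivOfCardEq hcard
  let ω := (NumberField.integralBasis K).reindex e
  have hω : ∀ i, ω i = (NumberField.RingOfIntegers.basis K (e.symm i) : K) := by
    intro i
    rw [Basis.reindex_apply, NumberField.integralBasis_apply]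
  refine ⟨ω, fun i => ?_, fun x hx i => ?_, ?_⟩
  · rw [hω]
    exact NumberField.RingOfIntegers.isIntegral_coe _
  · have := NumberField.integralBasis_repr_apply K (⟨x, hx⟩ : NumberField.RingOfIntegers K)
      (e.symm i)
    rw [Basis.repr_reindex_apply]
    exact ⟨_, this⟩
  · refine AddSubgroup.relIndex_eq_abs_det _ _ ?_ B ω ?_ ?_
    · rw [Submodule.toAddSubgroup_le, Subalgebra.toSubmodule.le_iff_le]
      exact adjoin_le_integralClosure ⟨f, hf, hfθ⟩
    · rw [← Submodule.span_int_eq_addSubgroupClosure]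
      congr 1
      rw [← Submodule.span_range_natDegree_eq_adjoin hf hfθ, hdeg]
      congr 1
      ext y
      simp only [Finset.coe_image, Finset.coe_range, Set.mem_image, Set.mem_Iio, Set.mem_range, hB]
      exact ⟨fun ⟨i, hi, h⟩ => ⟨⟨i, hi⟩, h⟩, fun ⟨i, h⟩ => ⟨i, i.2, h⟩⟩
    · rw [← Submodule.span_int_eq_addSubgroupClosure]
      congr 1
      have hr : Set.range ω = Set.range (NumberField.integralBasis K) := Basis.range_reindex _ _
      ext y
      rw [hr, NumberField.mem_span_integralBasis]
      constructor
      · intro hy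
        exact ⟨⟨y, hy⟩, rfl⟩
      · rintro ⟨y, rfl⟩
        exact NumberField.RingOfIntegers.isIntegral_coe y

theorem integerIndex_ne_zero {K : Type*} [Field K] [NumberField K] {n : ℕ} {θ : K}
    {f : Polynomial ℤ} (hf : f.Monic) (hdeg : f.natDegree = n) (hfθ : Polynomial.aeval θ f = 0)
    (B : Basis (Fin n) ℚ K) (hB : ∀ i, B i = θ ^ (i : ℕ)) : integerIndex θ ≠ 0 := by
  obtain ⟨ω, -, -, h⟩ := exists_basis_integerIndex_eq_abs_det hf hdeg hfθ B hB
  have h0 : ω.det B ≠ 0 := (ω.isUnit_det B).ne_zero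
  intro h'
  rw [h', Nat.cast_zero, eq_comm, abs_eq_zero] at h
  exact h0 h

/-- The matrix expressing `p ^ kⱼ bⱼ = Qⱼ(θ)`, with `Qⱼ` monic of degree `j`, in terms of the powers
of `θ` is triangular. -/
theorem det_eq_prod_of_triangular {K : Type*} [Field K] [CharZero K] {n : ℕ} {θ : K}
    (B : Basis (Fin n) ℚ K) (hB : ∀ i, B i = θ ^ (i : ℕ)) {q : ℚ} (hq : q ≠ 0) {b : Fin n → K}
    (k : Fin n → ℕ) (Q : Fin n → Polynomial ℚ) (hQ : ∀ j, (Q j).Monic)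
    (hdeg : ∀ j, (Q j).natDegree = j)
    (hb : ∀ j, (q : K) ^ k j * b j = Polynomial.aeval θ (Q j)) :
    B.det b = (q ^ ∑ j, k j)⁻¹ := by
  have hentry : ∀ i j, B.toMatrix b i j = (q ^ k j)⁻¹ * (Q j).coeff i := by
    intro i j
    have h1 : b j = (q ^ k j)⁻¹ • ∑ l : Fin n, (Q j).coeff l • B l := by
      rw [eq_inv_smul_iff₀ (pow_ne_zero _ hq), Rat.smul_def]
      push_cast
      rw [hb, Polynomial.aeval_eq_sum_range' (n := n) (by rw [hdeg]; exact j.2),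
        ← Fin.sum_univ_eq_sum_range (fun l => (Q j).coeff l • θ ^ l)]
      simp only [hB]
    rw [Basis.toMatrix_apply, h1, map_smul, Finsupp.smul_apply, Basis.repr_sum_self, smul_eq_mul]
  rw [Basis.det_apply, Matrix.det_of_isUpperTriangular, ← Finset.prod_pow_eq_pow_sum,
    ← Finset.prod_inv_distrib]
  · refine Finset.prod_congr rfl fun j _ => ?_
    rw [hentry]
    have := (hQ j).coeff_natDegree
    rw [hdeg] at this
    rw [this, mul_one]
  · intro i j hij
    rw [hentry, Polynomial.coeff_eq_zero_of_natDegree_lt, mul_zero]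
    rw [hdeg]
    exact hij

/-- A `p`-integral basis of integral elements which is triangular in the powers of `θ` gives the
valuation of the index of `ℤ[θ]`: its matrix over a `ℤ`-basis of the ring of integers is invertible
over `ℤ_(p)`. -/
theorem padicValNat_integerIndex_eq_sum {K : Type*} [Field K] [NumberField K] {n : ℕ} {θ : K}
    {f : Polynomial ℤ} (hf : f.Monic) (hfdeg : f.natDegree = n) (hfθ : Polynomial.aeval θ f = 0)
    (B : Basis (Fin n) ℚ K) (hB : ∀ i, B i = θ ^ (i : ℕ)) {p : ℕ} [Fact p.Prime] {b : Fin n → K}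
    (hb : ∀ i, IsIntegral ℤ (b i)) (hbasis : IsPIntegralBasis p b)
    (k : Fin n → ℕ) (Q : Fin n → Polynomial ℚ) (hQ : ∀ j, (Q j).Monic)
    (hdeg : ∀ j, (Q j).natDegree = j)
    (hbQ : ∀ j, (p : K) ^ k j * b j = Polynomial.aeval θ (Q j)) :
    padicValNat p (integerIndex θ) = ∑ j, k j := by
  have hpq : (p : ℚ) ≠ 0 := by exact_mod_cast (Fact.out : p.Prime).ne_zero
  obtain ⟨ω, hωint, hωrepr, hind⟩ := exists_basis_integerIndex_eq_abs_det hf hfdeg hfθ B hB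
  have hdetB : B.det b = ((p : ℚ) ^ ∑ j, k j)⁻¹ :=
    det_eq_prod_of_triangular B hB hpq k Q hQ hdeg (by exact_mod_cast hbQ)
  have hprod : ω.det b = ω.det B * B.det b := by
    simp only [Basis.det_apply]
    rw [← Matrix.det_mul, Basis.toMatrix_mul_toMatrix]
  choose a ha using fun j i => hωrepr (b j) (hb j) i
  have hdet₁ : ω.det b ∈ localizedIntegers p := by
    have : ω.toMatrix b = (Int.castRingHom ℚ).mapMatrix (Matrix.of fun i j => a j i) := by
      ext i j
      simp [Basis.toMatrix_apply, ha]
    rw [Basis.det_apply, this, ← RingHom.map_det]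
    exact intCast_mem _ _
  have hmem : ∀ j, ω j ∈ Submodule.span (localizedIntegers p) (Set.range b) := by
    intro j
    rw [hbasis.2]
    exact (hωint j).tower_top (A := localizedIntegers p)
  choose r hr using fun j => (Submodule.mem_span_range_iff_exists_fun _).1 (hmem j)
  let M : Matrix (Fin n) (Fin n) (localizedIntegers p) := Matrix.of fun l j => r j l
  have hmul : ω.det b * (M.det : ℚ) = 1 := by
    have h1 : ω.toMatrix b * (localizedIntegers p).subtype.mapMatrix M = 1 := by
      ext i j
      have h2 := congrArg (fun x => ω.repr x i) (hr j)
      simp only [map_sum, Finsupp.coe_finsetSum, Finset.sum_apply, Basis.repr_self] at h2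
      rw [Matrix.mul_apply, Matrix.one_apply]
      rw [Finsupp.single_apply] at h2
      simp only [eq_comm (a := i)]
      rw [← h2]
      refine Finset.sum_congr rfl fun l _ => ?_
      rw [show r j l • b l = (r j l : ℚ) • b l from rfl, map_smul, Finsupp.smul_apply,
        Basis.toMatrix_apply, smul_eq_mul, mul_comm]
      rfl
    have h3 := congrArg Matrix.det h1
    rw [Matrix.det_mul, Matrix.det_one, ← RingHom.map_det, ← Basis.det_apply] at h3
    exact h3
  have hne₁ : ω.det b ≠ 0 := left_ne_zero_of_mul_eq_one hmul
  have hne₂ : (M.det : ℚ) ≠ 0 := right_ne_zero_of_mul_eq_one hmul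
  have hv := congrArg (padicValRat p) hmul
  rw [padicValRat.mul hne₁ hne₂, padicValRat.one] at hv
  have hv₁ := (mem_localizedIntegers_iff_padicValRat hne₁).1 hdet₁
  have hv₂ := (mem_localizedIntegers_iff_padicValRat hne₂).1 M.det.2
  have hv₀ : padicValRat p (ω.det b) = 0 := by omega
  have hneB : ω.det B ≠ 0 := left_ne_zero_of_mul (hprod ▸ hne₁)
  rw [hprod, hdetB, padicValRat.mul hneB (inv_ne_zero (pow_ne_zero _ hpq)), padicValRat.inv,
    padicValRat.pow, padicValRat.self (Fact.out : p.Prime).one_lt] at hv₀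
  have habs : padicValRat p |ω.det B| = padicValRat p (ω.det B) := by
    rcases abs_choice (ω.det B) with h | h <;> rw [h]
    rw [padicValRat.neg]
  rw [← habs, ← hind, padicValRat.of_nat] at hv₀
  have : (padicValNat p (integerIndex θ) : ℤ) = ((∑ j, k j : ℕ) : ℤ) := by linarith
  exact_mod_cast this

end Index

/-! ### The pure field of degree twelve -/

section PureField

open Module

theorem isIntegral_of_pow_twelve_eq {K : Type*} [Field K] {m : ℤ} {θ : K} (hθ : θ ^ 12 = (m : K)) : IsIntegral ℤ θ :=
  IsIntegral.of_pow (n := 12) (by norm_num) (by rw [hθ]; exact isIntegral_algebraMap (R := ℤ))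

variable {K : Type*} [Field K] [NumberField K] {m : ℤ} {θ : K}

/-- The powers of `θ` form a basis, and every 12th root of `m` in an extension of `ℚ` is the image of
`θ` under an embedding. -/
theorem exists_basis_pow (hirr : Irreducible (Polynomial.X ^ 12 - Polynomial.C (m : ℚ)))
    (hθ : θ ^ 12 = (m : K)) (hK : IntermediateField.adjoin ℚ {θ} = ⊤) :
    ∃ B : Basis (Fin 12) ℚ K, (∀ i, B i = θ ^ (i : ℕ)) ∧
      ∀ (L : Type) [Field L] [Algebra ℚ L] (t : L), t ^ 12 = (m : L) →
        ∃ φ : K →ₐ[ℚ] L, φ θ = t := by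
  have hint : IsIntegral ℚ θ := Algebra.IsIntegral.isIntegral θ
  have hmin : minpoly ℚ θ = Polynomial.X ^ 12 - Polynomial.C (m : ℚ) :=
    (minpoly.eq_of_irreducible_of_monic hirr (by simp [hθ])
      (Polynomial.monic_X_pow_sub_C _ (by norm_num))).symm
  have hadj : Algebra.adjoin ℚ {θ} = ⊤ := by
    rw [← IntermediateField.adjoin_simple_toSubalgebra_of_isAlgebraic hint.isAlgebraic, hK]
    rfl
  let pb := PowerBasis.ofAdjoinEqTop hint hadj
  have hgen : pb.gen = θ := PowerBasis.ofAdjoinEqTop_gen hint hadj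
  have hdim : pb.dim = 12 := by
    rw [PowerBasis.ofAdjoinEqTop_dim, hmin, Polynomial.natDegree_X_pow_sub_C]
  refine ⟨pb.basis.reindex (finCongr hdim), fun i => ?_, fun L _ _ t ht => ?_⟩
  · rw [Basis.reindex_apply, pb.basis_eq_pow, hgen]
    rfl
  · refine ⟨pb.lift t ?_, ?_⟩
    · rw [hgen, hmin]
      simp [ht]
    · exact pb.lift_gen t _

/-- The conjugates of a `ℤ_(p)`-integral element in an algebraic closure of `ℚ_p` are integral. -/
theorem exists_coeff_of_isIntegral (hirr : Irreducible (Polynomial.X ^ 12 - Polynomial.C (m : ℚ)))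
    (hθ : θ ^ 12 = (m : K)) (hK : IntermediateField.adjoin ℚ {θ} = ⊤) {p : ℕ} [Fact p.Prime]
    {x : K} (hx : IsIntegral (localizedIntegers p) x) :
    ∃ c : ℕ → ℚ, x = ∑ i ∈ Finset.range 12, (c i : K) * θ ^ i ∧
      ∀ t : PadicAlgCl p, t ^ 12 = m →
        ∑ i ∈ Finset.range 12, (c i : PadicAlgCl p) * t ^ i ∈ unitBall p := by
  obtain ⟨B, hB, hφ⟩ := exists_basis_pow hirr hθ hK
  let c : ℕ → ℚ := fun i => if h : i < 12 then B.repr x ⟨i, h⟩ else 0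
  have hxc : x = ∑ i ∈ Finset.range 12, (c i : K) * θ ^ i := by
    rw [← Fin.sum_univ_eq_sum_range (fun i => (c i : K) * θ ^ i)]
    conv_lhs => rw [← B.sum_repr x]
    refine Finset.sum_congr rfl fun i _ => ?_
    rw [hB, Rat.smul_def]
    simp [c]
  refine ⟨c, hxc, fun t ht => ?_⟩
  obtain ⟨φ, hφt⟩ := hφ (PadicAlgCl p) t ht
  have h := mem_unitBall_of_isIntegral (p := p)
    (hx.map_of_comp_eq (RingHom.id (localizedIntegers p)) (φ : K →+* PadicAlgCl p)
      (by ext r; exact (φ.commutes (r : ℚ)).symm))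
  convert h using 1
  conv_rhs => rw [hxc]
  simp [hφt]

/-- The conjugation `θ ↦ ζ θ` by roots of unity of order `N` prime to `p` splits integral elements
into integral parts. -/
theorem sum_filter_mem_unitBall {p : ℕ} [Fact p.Prime] {c : ℕ → ℚ}
    (hc : ∀ t : PadicAlgCl p, t ^ 12 = m →
      ∑ i ∈ Finset.range 12, (c i : PadicAlgCl p) * t ^ i ∈ unitBall p)
    {N : ℕ} (hN : ¬ p ∣ N) (hN12 : N ∣ 12) {t : PadicAlgCl p} (ht : t ^ 12 = m) {r : ℕ}
    (hr : r < N) :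
    ∑ i ∈ Finset.range 12 with i % N = r, (c i : PadicAlgCl p) * t ^ i ∈ unitBall p := by
  have hN0 : 0 < N := Nat.pos_of_dvd_of_pos hN12 (by norm_num)
  have : NeZero (N : PadicAlgCl p) := ⟨by exact_mod_cast hN0.ne'⟩
  obtain ⟨ζ, hζ⟩ := HasEnoughRootsOfUnity.exists_primitiveRoot (PadicAlgCl p) N
  refine sum_filter_mod_mem_unitBall hN hN0 hζ 12 (fun i => (c i : PadicAlgCl p)) t
    (fun k => hc _ ?_) hr
  rw [mul_pow, ht, ← pow_mul, mul_comm, (hζ.pow_eq_one_iff_dvd _).2 (hN12.mul_left k), mul_one]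

theorem mem_span_range_of_eq_sum {F : Type*} [Field F] [CharZero F] {p : ℕ} {ι : Type*}
    [Fintype ι] {b : ι → F} {x : F} (a : ι → ℚ) (ha : ∀ j, a j ∈ localizedIntegers p)
    (hx : x = ∑ j, (a j : F) * b j) :
    x ∈ Submodule.span (localizedIntegers p) (Set.range b) := by
  rw [hx]
  refine Submodule.sum_mem _ fun j _ => ?_
  have := Submodule.smul_mem (Submodule.span (localizedIntegers p) (Set.range b)) ⟨a j, ha j⟩
    (Submodule.subset_span (Set.mem_range_self j))
  rwa [Subring.smul_def, Rat.smul_def] at this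

/-- Here `hsep` says that exponents which agree modulo `N` and have `i v / 12` equal modulo `1` agree
modulo `12`. -/
theorem mul_pow_mem_localizedIntegers {p : ℕ} [Fact p.Prime] (hm0 : m ≠ 0) {c : ℕ → ℚ}
    (hc : ∀ t : PadicAlgCl p, t ^ 12 = m →
      ∑ i ∈ Finset.range 12, (c i : PadicAlgCl p) * t ^ i ∈ unitBall p)
    {N : ℕ} (hN : ¬ p ∣ N) (hN12 : N ∣ 12)
    (hsep : ∀ k : ℤ, (12 : ℤ) ∣ N * k * padicValInt p m → (12 : ℤ) ∣ N * k) {i : ℕ} (hi : i < 12) :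
    c i * (p : ℚ) ^ (i * padicValInt p m / 12) ∈ localizedIntegers p := by
  obtain ⟨t, ht⟩ := IsAlgClosed.exists_pow_nat_eq (m : PadicAlgCl p) (n := 12) (by norm_num)
  have htn : ‖t‖ ^ 12 = (p : ℝ) ^ (-(padicValInt p m : ℤ)) := by
    have := norm_ratCast_eq_zpow (p := p) (q := m) (by exact_mod_cast hm0)
    rw [padicValRat.of_int] at this
    rw [← norm_pow, ht, ← this]
    simp
  have hN0 : 0 < N := Nat.pos_of_dvd_of_pos hN12 (by norm_num)
  refine mul_pow_mem_of_sum_mem_unitBall (by norm_num) htn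
    {j ∈ Finset.range 12 | j % N = i % N} ?_ c
    (sum_filter_mem_unitBall hc hN hN12 ht (Nat.mod_lt i hN0)) i (by simp [hi])
  intro j hj l hl hjl
  simp only [Finset.mem_filter, Finset.mem_range] at hj hl
  obtain ⟨k, hk⟩ : (N : ℤ) ∣ (j : ℤ) - l :=
    (Nat.modEq_iff_dvd.1 (hl.2.trans hj.2.symm : l ≡ j [MOD N]))
  rw [hk] at hjl
  have := hsep k (by exact_mod_cast hjl)
  rw [← hk] at this
  omega

/-- The part with exponents `≡ r` modulo `4` is `θ ^ r` times an element of the pure cubic field. -/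
theorem cubic_coeff_mem_unitBall [Fact (Nat.Prime 3)] (hm : ¬ (3 : ℤ) ∣ m) {c : ℕ → ℚ}
    (hc : ∀ t : PadicAlgCl 3, t ^ 12 = m →
      ∑ i ∈ Finset.range 12, (c i : PadicAlgCl 3) * t ^ i ∈ unitBall 3) {r : ℕ} (hr : r < 4)
    (s : PadicAlgCl 3) (hs : s ^ 3 = m) :
    (c r : PadicAlgCl 3) + c (r + 4) * s + c (r + 8) * s ^ 2 ∈ unitBall 3 := by
  obtain ⟨t, rfl⟩ := IsAlgClosed.exists_pow_nat_eq s (n := 4) (by norm_num)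
  have ht : t ^ 12 = m := by rw [← hs]; ring
  have h := sum_filter_mem_unitBall hc (N := 4) (by norm_num) (by norm_num) ht hr
  refine mem_unitBall_of_mul_mem (x := t ^ r)
    (by rw [norm_pow, norm_eq_one_of_pow_eq_intCast (by norm_num) hm ht, one_pow]) ?_
  interval_cases r <;> simp [Finset.sum_filter, Finset.sum_range_succ] at h <;>
    convert h using 1 <;> ring

/-- The part with exponents `≡ r` modulo `3` is `θ ^ r` times an element of the pure quartic field. -/
theorem quartic_coeff_mem_unitBall [Fact (Nat.Prime 2)] (hm : ¬ (2 : ℤ) ∣ m) {c : ℕ → ℚ}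
    (hc : ∀ t : PadicAlgCl 2, t ^ 12 = m →
      ∑ i ∈ Finset.range 12, (c i : PadicAlgCl 2) * t ^ i ∈ unitBall 2) {r : ℕ} (hr : r < 3)
    (s : PadicAlgCl 2) (hs : s ^ 4 = m) :
    (c r : PadicAlgCl 2) + c (r + 3) * s + c (r + 6) * s ^ 2 + c (r + 9) * s ^ 3 ∈ unitBall 2 := by
  obtain ⟨t, rfl⟩ := IsAlgClosed.exists_pow_nat_eq s (n := 3) (by norm_num)
  have ht : t ^ 12 = m := by rw [← hs]; ring
  have h := sum_filter_mem_unitBall hc (N := 3) (by norm_num) (by norm_num) ht hr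
  refine mem_unitBall_of_mul_mem (x := t ^ r)
    (by rw [norm_pow, norm_eq_one_of_pow_eq_intCast (by norm_num) hm ht, one_pow]) ?_
  interval_cases r <;> simp [Finset.sum_filter, Finset.sum_range_succ] at h <;>
    convert h using 1 <;> ring

/-- The common last step of all cases: a family of integral elements, triangular in the powers of
`θ`, which spans the `ℤ_(p)`-integral elements. -/
theorem padicValNat_integerIndex_and_isPIntegralBasis
    (hirr : Irreducible (Polynomial.X ^ 12 - Polynomial.C (m : ℚ)))
    (hθ : θ ^ 12 = (m : K)) (hK : IntermediateField.adjoin ℚ {θ} = ⊤) {p : ℕ} [Fact p.Prime]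
    {b : Fin 12 → K} (hb : ∀ i, IsIntegral ℤ (b i))
    (hspan : ∀ c : ℕ → ℚ, (∀ t : PadicAlgCl p, t ^ 12 = m →
        ∑ i ∈ Finset.range 12, (c i : PadicAlgCl p) * t ^ i ∈ unitBall p) →
      ∃ a : Fin 12 → ℚ, (∀ j, a j ∈ localizedIntegers p) ∧
        ∑ i ∈ Finset.range 12, (c i : K) * θ ^ i = ∑ j, (a j : K) * b j)
    (k : Fin 12 → ℕ) (Q : Fin 12 → Polynomial ℚ) (hQ : ∀ j, (Q j).Monic)
    (hdeg : ∀ j, (Q j).natDegree = j)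
    (hbQ : ∀ j, (p : K) ^ k j * b j = Polynomial.aeval θ (Q j)) :
    padicValNat p (integerIndex θ) = ∑ j, k j ∧ IsPIntegralBasis p b := by
  obtain ⟨B, hB, -⟩ := exists_basis_pow hirr hθ hK
  have hbasis : IsPIntegralBasis p b := by
    refine isPIntegralBasis_of_forall_mem_span B rfl
      (fun i => by rw [hB]; exact (isIntegral_of_pow_twelve_eq hθ).pow _) hb fun x hx => ?_
    obtain ⟨c, hxc, hc⟩ := exists_coeff_of_isIntegral hirr hθ hK hx
    obtain ⟨a, ha, hac⟩ := hspan c hc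
    exact mem_span_range_of_eq_sum a ha (hxc.trans hac)
  refine ⟨?_, hbasis⟩
  exact padicValNat_integerIndex_eq_sum (f := Polynomial.X ^ 12 - Polynomial.C m)
    (Polynomial.monic_X_pow_sub_C _ (by norm_num)) Polynomial.natDegree_X_pow_sub_C
    (by simp [hθ]) B hB hb hbasis k Q hQ hdeg hbQ

end PureField

/-! ### The basis for each prime -/

section Cases

variable {K : Type*} [Field K] [NumberField K] {m : ℤ} {θ : K}

theorem isIntegral_pow_div_prime_pow (hθ : θ ^ 12 = (m : K)) {p : ℕ} [Fact p.Prime] (i : ℕ) :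
    IsIntegral ℤ (θ ^ i / (p : K) ^ (i * padicValInt p m / 12)) := by
  have hp : (p : K) ≠ 0 := by exact_mod_cast (Fact.out : p.Prime).ne_zero
  obtain ⟨u, hu⟩ := padicValInt_dvd (p := p) m
  have hle : i * padicValInt p m / 12 * 12 ≤ i * padicValInt p m := Nat.div_mul_le_self _ _
  generalize i * padicValInt p m / 12 = k at hle ⊢
  obtain ⟨d, hd⟩ := Nat.exists_eq_add_of_le hle
  refine IsIntegral.of_pow (n := 12) (by norm_num) ?_
  have : (θ ^ i / (p : K) ^ k) ^ 12 = ((p ^ d * u ^ i : ℤ) : K) := by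
    have hmK : (m : K) = (p : K) ^ padicValInt p m * u := by
      have := congrArg (Int.cast : ℤ → K) hu
      push_cast at this
      exact this
    rw [div_pow, pow_right_comm, hθ, ← pow_mul, div_eq_iff (pow_ne_zero _ hp), hmK, mul_pow,
      ← pow_mul, mul_comm (padicValInt p m), hd]
    push_cast
    ring
  rw [this]
  exact isIntegral_algebraMap (R := ℤ)

/-- Exponents start at `0` here, which makes the family triangular in the powers of `θ`. -/
theorem isPIntegralBasis_pow_div_prime_pow
    (hirr : Irreducible (Polynomial.X ^ 12 - Polynomial.C (m : ℚ)))
    (hθ : θ ^ 12 = (m : K)) (hK : IntermediateField.adjoin ℚ {θ} = ⊤) (hm0 : m ≠ 0) {p : ℕ}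
    [Fact p.Prime] {N : ℕ} (hN : ¬ p ∣ N) (hN12 : N ∣ 12)
    (hsep : ∀ k : ℤ, (12 : ℤ) ∣ N * k * padicValInt p m → (12 : ℤ) ∣ N * k) :
    padicValNat p (integerIndex θ) = ∑ j : Fin 12, (j : ℕ) * padicValInt p m / 12 ∧
      IsPIntegralBasis p (fun i : Fin 12 =>
        θ ^ (i : ℕ) / (p : K) ^ ((i : ℕ) * padicValInt p m / 12)) := by
  have hp : (p : K) ≠ 0 := by exact_mod_cast (Fact.out : p.Prime).ne_zero
  refine padicValNat_integerIndex_and_isPIntegralBasis hirr hθ hK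
    (fun i => isIntegral_pow_div_prime_pow hθ i) (fun c hc => ?_) _ (fun j => Polynomial.X ^ (j : ℕ))
    (fun j => Polynomial.monic_X_pow _) (fun j => Polynomial.natDegree_X_pow _) (fun j => ?_)
  · refine ⟨fun j => c j * (p : ℚ) ^ ((j : ℕ) * padicValInt p m / 12),
      fun j => mul_pow_mem_localizedIntegers hm0 hc hN hN12 hsep j.2, ?_⟩
    rw [← Fin.sum_univ_eq_sum_range (fun i => (c i : K) * θ ^ i)]
    refine Finset.sum_congr rfl fun j _ => ?_
    push_cast
    field_simp
  · rw [mul_div_cancel₀ _ (pow_ne_zero _ hp)]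
    simp

/-- Since `θ ^ 12 / p ^ v = m / p ^ v` is a unit at `p`, it may replace `1` in the basis. -/
theorem isPIntegralBasis_succ_of_isPIntegralBasis
    (hirr : Irreducible (Polynomial.X ^ 12 - Polynomial.C (m : ℚ)))
    (hθ : θ ^ 12 = (m : K)) (hK : IntermediateField.adjoin ℚ {θ} = ⊤) (hm0 : m ≠ 0) {p : ℕ}
    [Fact p.Prime]
    (h : IsPIntegralBasis p (fun i : Fin 12 =>
      θ ^ (i : ℕ) / (p : K) ^ ((i : ℕ) * padicValInt p m / 12))) :
    IsPIntegralBasis p (fun i : Fin 12 =>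
      θ ^ ((i : ℕ) + 1) / (p : K) ^ (((i : ℕ) + 1) * padicValInt p m / 12)) := by
  have hp : (p : K) ≠ 0 := by exact_mod_cast (Fact.out : p.Prime).ne_zero
  have hpq : (p : ℚ) ≠ 0 := by exact_mod_cast (Fact.out : p.Prime).ne_zero
  have hmq : (m : ℚ) ≠ 0 := by exact_mod_cast hm0
  have hmK : (m : K) ≠ 0 := by exact_mod_cast hm0
  obtain ⟨B, hB, -⟩ := exists_basis_pow hirr hθ hK
  refine isPIntegralBasis_of_forall_mem_span B rfl
    (fun i => by rw [hB]; exact (isIntegral_of_pow_twelve_eq hθ).pow _)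
    (fun i => isIntegral_pow_div_prime_pow hθ _) fun x hx => ?_
  have hx' : x ∈ Subalgebra.toSubmodule (integralClosure (localizedIntegers p) K) := hx
  rw [← h.2] at hx'
  revert x
  suffices hle : Submodule.span (localizedIntegers p) (Set.range fun i : Fin 12 =>
      θ ^ (i : ℕ) / (p : K) ^ ((i : ℕ) * padicValInt p m / 12)) ≤
      Submodule.span (localizedIntegers p) (Set.range fun i : Fin 12 =>
        θ ^ ((i : ℕ) + 1) / (p : K) ^ (((i : ℕ) + 1) * padicValInt p m / 12)) from
    fun x _ hx => hle hx
  rw [Submodule.span_le]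
  rintro _ ⟨i, rfl⟩
  rcases Fin.eq_zero_or_eq_succ i with rfl | ⟨j, rfl⟩
  · have hu : (p : ℚ) ^ padicValInt p m / m ∈ localizedIntegers p := by
      rw [mem_localizedIntegers_iff_padicValRat (div_ne_zero (pow_ne_zero _ hpq) hmq),
        padicValRat.div (pow_ne_zero _ hpq) hmq, padicValRat.pow,
        padicValRat.self (Fact.out : p.Prime).one_lt, padicValRat.of_int]
      simp
    have := Submodule.smul_mem _ (⟨_, hu⟩ : localizedIntegers p)
      (Submodule.subset_span (R := localizedIntegers p) (Set.mem_range_self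
      (f := fun i : Fin 12 =>
        θ ^ ((i : ℕ) + 1) / (p : K) ^ (((i : ℕ) + 1) * padicValInt p m / 12)) 11))
    rw [SetLike.mem_coe]
    convert this using 1
    rw [Subring.smul_def, Rat.smul_def]
    have h12 : ((11 : Fin 12) : ℕ) + 1 = 12 := rfl
    rw [h12, hθ, Nat.mul_div_cancel_left _ (by norm_num)]
    push_cast
    simp only [Fin.val_zero, pow_zero, zero_mul, Nat.zero_div, div_one]
    field_simp
  · refine Submodule.subset_span ⟨j.castSucc, ?_⟩
    simp

theorem isPIntegralBasis_pow
    (hirr : Irreducible (Polynomial.X ^ 12 - Polynomial.C (m : ℚ)))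
    (hθ : θ ^ 12 = (m : K)) (hK : IntermediateField.adjoin ℚ {θ} = ⊤) {p : ℕ} [Fact p.Prime]
    (h : ∀ c : ℕ → ℚ, (∀ t : PadicAlgCl p, t ^ 12 = m →
        ∑ i ∈ Finset.range 12, (c i : PadicAlgCl p) * t ^ i ∈ unitBall p) →
      ∀ i < 12, c i ∈ localizedIntegers p) :
    padicValNat p (integerIndex θ) = 0 ∧ IsPIntegralBasis p (fun i : Fin 12 => θ ^ (i : ℕ)) := by
  have := padicValNat_integerIndex_and_isPIntegralBasis hirr hθ hK (p := p)
    (b := fun i : Fin 12 => θ ^ (i : ℕ))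
    (fun i => (isIntegral_of_pow_twelve_eq hθ).pow _)
    (fun c hc => ⟨fun j => c j, fun j => h c hc j j.2,
      (Fin.sum_univ_eq_sum_range (fun i => (c i : K) * θ ^ i) 12).symm⟩)
    (fun _ => 0) (fun j => Polynomial.X ^ (j : ℕ))
    (fun j => Polynomial.monic_X_pow _) (fun j => Polynomial.natDegree_X_pow _) (fun j => by simp)
  simpa using this

theorem isPIntegralBasis_three_of_modEq [Fact (Nat.Prime 3)]
    (hirr : Irreducible (Polynomial.X ^ 12 - Polynomial.C (m : ℚ)))
    (hθ : θ ^ 12 = (m : K)) (hK : IntermediateField.adjoin ℚ {θ} = ⊤) (hm : ¬ (3 : ℤ) ∣ m)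
    (hm9 : m ^ 2 ≡ 1 [ZMOD 9]) :
    padicValNat 3 (integerIndex θ) = 4 ∧
      IsPIntegralBasis 3
        (let h : K := θ ^ 8 + (m : K) * θ ^ 4 + 1
         ![1, θ, θ ^ 2, θ ^ 3, θ ^ 4, θ ^ 5, θ ^ 6, θ ^ 7,
           h / 3, θ * h / 3, θ ^ 2 * h / 3, θ ^ 3 * h / 3]) := by
  have hθi := isIntegral_of_pow_twelve_eq hθ
  have hη : IsIntegral ℤ ((θ ^ 8 + (m : K) * θ ^ 4 + 1) / 3) := by
    have := isIntegral_cubic_generator (s := θ ^ 4) (by rw [← hθ]; ring) hm9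
    rwa [← pow_mul] at this
  set h : Polynomial ℚ := Polynomial.X ^ 8 + Polynomial.C (m : ℚ) * Polynomial.X ^ 4 + 1 with hh
  have hdeg : h.natDegree = 8 := by rw [hh]; compute_degree!
  have hmonic : h.Monic := by rw [hh]; monicity!
  refine padicValNat_integerIndex_and_isPIntegralBasis hirr hθ hK ?_ (fun c hc => ?_)
    ![0, 0, 0, 0, 0, 0, 0, 0, 1, 1, 1, 1]
    (fun j => if (j : ℕ) < 8 then Polynomial.X ^ (j : ℕ) else Polynomial.X ^ ((j : ℕ) - 8) * h)
    (fun j => ?_) (fun j => ?_) (fun j => ?_)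
  · simp only [Fin.forall_fin_succ, mul_div_assoc]
    simp [isIntegral_one, hθi, hθi.pow, hη, hθi.mul hη, (hθi.pow _).mul hη]
  · have key := fun r hr =>
      cubic_coeff_mem_of_modEq hm hm9 (cubic_coeff_mem_unitBall hm hc (r := r) hr)
    refine ⟨![c 0 - c 8, c 1 - c 9, c 2 - c 10, c 3 - c 11, c 4 - m * c 8, c 5 - m * c 9,
      c 6 - m * c 10, c 7 - m * c 11, 3 * c 8, 3 * c 9, 3 * c 10, 3 * c 11], ?_, ?_⟩
    · have k0 := key 0 (by norm_num)
      have k1 := key 1 (by norm_num)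
      have k2 := key 2 (by norm_num)
      have k3 := key 3 (by norm_num)
      simp only [Fin.forall_fin_succ]
      simp_all
    · simp [Fin.sum_univ_succ, Finset.sum_range_succ]
      ring
  · split_ifs
    exacts [Polynomial.monic_X_pow _, (Polynomial.monic_X_pow _).mul hmonic]
  · split_ifs
    · exact Polynomial.natDegree_X_pow _
    · rw [(Polynomial.monic_X_pow _).natDegree_mul hmonic, Polynomial.natDegree_X_pow, hdeg]
      omega
  · fin_cases j <;> simp [hh] <;> ring

theorem isPIntegralBasis_two_of_modEq_one [Fact (Nat.Prime 2)]
    (hirr : Irreducible (Polynomial.X ^ 12 - Polynomial.C (m : ℚ)))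
    (hθ : θ ^ 12 = (m : K)) (hK : IntermediateField.adjoin ℚ {θ} = ⊤)
    (hm8 : m ≡ 1 [ZMOD 8]) :
    padicValNat 2 (integerIndex θ) = 9 ∧
      IsPIntegralBasis 2
        (let g : K := θ ^ 9 + θ ^ 6 + θ ^ 3 + 1
         ![1, θ, θ ^ 2, θ ^ 3, θ ^ 4, θ ^ 5,
           (θ ^ 6 - 1) / 2, θ * (θ ^ 6 - 1) / 2, θ ^ 2 * (θ ^ 6 - 1) / 2,
           g / 2 ^ 2, θ * g / 2 ^ 2, θ ^ 2 * g / 2 ^ 2]) := by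
  have hm : ¬ (2 : ℤ) ∣ m := by
    have := hm8.symm.dvd
    omega
  have hθi := isIntegral_of_pow_twelve_eq hθ
  have hs : (θ ^ 3) ^ 4 = (m : K) := by rw [← hθ]; ring
  have hδ : IsIntegral ℤ ((θ ^ 6 - 1) / 2) := by
    have := isIntegral_quadratic_generator hs (hm8.of_mul_left 2)
    rwa [← pow_mul] at this
  have hγ : IsIntegral ℤ ((θ ^ 9 + θ ^ 6 + θ ^ 3 + 1) / 2 ^ 2) := by
    have := isIntegral_quartic_generator hs hm8
    rw [← pow_mul, ← pow_mul] at this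
    convert this using 2
    norm_num
  set d : Polynomial ℚ := Polynomial.X ^ 6 - 1 with hd
  set g : Polynomial ℚ := Polynomial.X ^ 9 + Polynomial.X ^ 6 + Polynomial.X ^ 3 + 1 with hg
  have hddeg : d.natDegree = 6 := by rw [hd]; compute_degree!
  have hdmonic : d.Monic := by rw [hd]; monicity!
  have hgdeg : g.natDegree = 9 := by rw [hg]; compute_degree!
  have hgmonic : g.Monic := by rw [hg]; monicity!
  refine padicValNat_integerIndex_and_isPIntegralBasis hirr hθ hK ?_ (fun c hc => ?_)
    ![0, 0, 0, 0, 0, 0, 1, 1, 1, 2, 2, 2]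
    (fun j => if (j : ℕ) < 6 then Polynomial.X ^ (j : ℕ) else
      if (j : ℕ) < 9 then Polynomial.X ^ ((j : ℕ) - 6) * d else Polynomial.X ^ ((j : ℕ) - 9) * g)
    (fun j => ?_) (fun j => ?_) (fun j => ?_)
  · simp only [Fin.forall_fin_succ, mul_div_assoc]
    simp [isIntegral_one, hθi, hθi.pow, hδ, hθi.mul hδ, (hθi.pow _).mul hδ, hγ, hθi.mul hγ,
      (hθi.pow _).mul hγ]
  · have key := fun r hr =>
      quartic_coeff_mem_of_modEq_one hm8 (quartic_coeff_mem_unitBall hm hc (r := r) hr)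
    refine ⟨![c 0 + c 6 - 2 * c 9, c 1 + c 7 - 2 * c 10, c 2 + c 8 - 2 * c 11, c 3 - c 9,
      c 4 - c 10, c 5 - c 11, 2 * (c 6 - c 9), 2 * (c 7 - c 10), 2 * (c 8 - c 11), 4 * c 9,
      4 * c 10, 4 * c 11], ?_, ?_⟩
    · have k0 := key 0 (by norm_num)
      have k1 := key 1 (by norm_num)
      have k2 := key 2 (by norm_num)
      simp only [Fin.forall_fin_succ]
      simp_all
    · simp [Fin.sum_univ_succ, Finset.sum_range_succ]
      ring
  · split_ifs
    exacts [Polynomial.monic_X_pow _, (Polynomial.monic_X_pow _).mul hdmonic,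
      (Polynomial.monic_X_pow _).mul hgmonic]
  · split_ifs
    · exact Polynomial.natDegree_X_pow _
    · rw [(Polynomial.monic_X_pow _).natDegree_mul hdmonic, Polynomial.natDegree_X_pow, hddeg]
      omega
    · rw [(Polynomial.monic_X_pow _).natDegree_mul hgmonic, Polynomial.natDegree_X_pow, hgdeg]
      omega
  · fin_cases j <;> simp [hd, hg] <;> ring

theorem isPIntegralBasis_two_of_modEq_five [Fact (Nat.Prime 2)]
    (hirr : Irreducible (Polynomial.X ^ 12 - Polynomial.C (m : ℚ)))
    (hθ : θ ^ 12 = (m : K)) (hK : IntermediateField.adjoin ℚ {θ} = ⊤)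
    (hm8 : m ≡ 5 [ZMOD 8]) :
    padicValNat 2 (integerIndex θ) = 6 ∧
      IsPIntegralBasis 2
        ![1, θ, θ ^ 2, θ ^ 3, θ ^ 4, θ ^ 5,
          (θ ^ 6 - 1) / 2, θ * (θ ^ 6 - 1) / 2, θ ^ 2 * (θ ^ 6 - 1) / 2,
          θ ^ 3 * (θ ^ 6 - 1) / 2, θ ^ 4 * (θ ^ 6 - 1) / 2, θ ^ 5 * (θ ^ 6 - 1) / 2] := by
  have hm : ¬ (2 : ℤ) ∣ m := by
    have := hm8.symm.dvd
    omega
  have hθi := isIntegral_of_pow_twelve_eq hθ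
  have hδ : IsIntegral ℤ ((θ ^ 6 - 1) / 2) := by
    have := isIntegral_quadratic_generator (s := θ ^ 3) (by rw [← hθ]; ring)
      ((hm8.of_mul_left 2 : m ≡ 5 [ZMOD 4]).trans (by decide : 5 ≡ 1 [ZMOD 4]))
    rwa [← pow_mul] at this
  set d : Polynomial ℚ := Polynomial.X ^ 6 - 1 with hd
  have hddeg : d.natDegree = 6 := by rw [hd]; compute_degree!
  have hdmonic : d.Monic := by rw [hd]; monicity!
  refine padicValNat_integerIndex_and_isPIntegralBasis hirr hθ hK ?_ (fun c hc => ?_)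
    ![0, 0, 0, 0, 0, 0, 1, 1, 1, 1, 1, 1]
    (fun j => if (j : ℕ) < 6 then Polynomial.X ^ (j : ℕ) else Polynomial.X ^ ((j : ℕ) - 6) * d)
    (fun j => ?_) (fun j => ?_) (fun j => ?_)
  · simp only [Fin.forall_fin_succ, mul_div_assoc]
    simp [isIntegral_one, hθi, hθi.pow, hδ, hθi.mul hδ, (hθi.pow _).mul hδ]
  · have key := fun r hr =>
      quartic_coeff_mem_of_modEq_five hm8 (quartic_coeff_mem_unitBall hm hc (r := r) hr)
    refine ⟨![c 0 + c 6, c 1 + c 7, c 2 + c 8, c 3 + c 9, c 4 + c 10, c 5 + c 11, 2 * c 6,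
      2 * c 7, 2 * c 8, 2 * c 9, 2 * c 10, 2 * c 11], ?_, ?_⟩
    · have k0 := key 0 (by norm_num)
      have k1 := key 1 (by norm_num)
      have k2 := key 2 (by norm_num)
      simp only [Fin.forall_fin_succ]
      simp_all
    · simp [Fin.sum_univ_succ, Finset.sum_range_succ]
      ring
  · split_ifs
    exacts [Polynomial.monic_X_pow _, (Polynomial.monic_X_pow _).mul hdmonic]
  · split_ifs
    · exact Polynomial.natDegree_X_pow _
    · rw [(Polynomial.monic_X_pow _).natDegree_mul hdmonic, Polynomial.natDegree_X_pow, hddeg]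
      omega
  · fin_cases j <;> simp [hd] <;> ring

/-- Among the divisors of `12` prime to `p`, the largest one separates the exponents. -/
theorem exists_dvd_twelve_separating {p : ℕ} (hp : p.Prime) {v : ℕ} (hv : ¬ p ∣ v) :
    ∃ N : ℕ, ¬ p ∣ N ∧ N ∣ 12 ∧ ∀ k : ℤ, (12 : ℤ) ∣ N * k * v → (12 : ℤ) ∣ N * k := by
  by_cases h2 : p = 2
  · subst h2
    refine ⟨3, by norm_num, by norm_num, fun k hk => ?_⟩
    have hcop : IsCoprime (4 : ℤ) v := by
      rw [show (4 : ℤ) = ((2 ^ 2 : ℕ) : ℤ) by norm_num, Nat.isCoprime_iff_coprime]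
      exact ((Nat.Prime.coprime_iff_not_dvd Nat.prime_two).2 hv).pow_left 2
    have h4 : (4 : ℤ) ∣ k * v := by
      push_cast at hk
      rw [mul_assoc] at hk
      omega
    have := hcop.dvd_of_dvd_mul_right h4
    push_cast
    omega
  by_cases h3 : p = 3
  · subst h3
    refine ⟨4, by norm_num, by norm_num, fun k hk => ?_⟩
    have hcop : IsCoprime (3 : ℤ) v := by
      rw [show (3 : ℤ) = ((3 : ℕ) : ℤ) by norm_num, Nat.isCoprime_iff_coprime]
      exact (Nat.Prime.coprime_iff_not_dvd Nat.prime_three).2 hv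
    have h3 : (3 : ℤ) ∣ k * v := by
      push_cast at hk
      rw [mul_assoc] at hk
      omega
    have := hcop.dvd_of_dvd_mul_right h3
    push_cast
    omega
  · refine ⟨12, fun h => ?_, dvd_rfl, fun k _ => ⟨k, by push_cast; ring⟩⟩
    rw [show 12 = 2 ^ 2 * 3 by norm_num, hp.dvd_mul] at h
    rcases h with h | h
    · exact h2 ((Nat.prime_dvd_prime_iff_eq hp Nat.prime_two).1 (hp.dvd_of_dvd_pow h))
    · exact h3 ((Nat.prime_dvd_prime_iff_eq hp Nat.prime_three).1 h)

end Cases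

theorem theorem2 {K : Type*} [Field K] [NumberField K] (m : ℤ) (θ : K)
    (hirr : Irreducible (Polynomial.X ^ 12 - Polynomial.C (m : ℚ) : Polynomial ℚ))
    (hfree : ∀ d : ℤ, d ^ 12 ∣ m → IsUnit d)
    (hθ : θ ^ 12 = (m : K))
    (hK : IntermediateField.adjoin ℚ {θ} = ⊤) :
    -- the index is finite, so that its valuations below are meaningful
    integerIndex θ ≠ 0 ∧
    -- (1)
    (∀ p : ℕ, p.Prime → (p : ℤ) ∣ m → ¬ p ∣ padicValInt p m →
      (padicValNat p (integerIndex θ) : ℚ) =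
          1 / 2 * (11 * ((padicValInt p m : ℚ) - 1)
            + ((Nat.gcd (padicValInt p m) 12 : ℚ) - 1)) ∧
        IsPIntegralBasis p (fun i : Fin 12 =>
          θ ^ ((i : ℕ) + 1) / (p : K) ^ (((i : ℕ) + 1) * padicValInt p m / 12))) ∧
    -- (2)
    (¬ (3 : ℤ) ∣ m →
      (m ^ 2 ≡ 1 [ZMOD 9] →
        padicValNat 3 (integerIndex θ) = 4 ∧
        IsPIntegralBasis 3
          (let h : K := θ ^ 8 + (m : K) * θ ^ 4 + 1
           ![1, θ, θ ^ 2, θ ^ 3, θ ^ 4, θ ^ 5, θ ^ 6, θ ^ 7,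
             h / 3, θ * h / 3, θ ^ 2 * h / 3, θ ^ 3 * h / 3])) ∧
      (¬ m ^ 2 ≡ 1 [ZMOD 9] →
        padicValNat 3 (integerIndex θ) = 0 ∧
        IsPIntegralBasis 3 (fun i : Fin 12 => θ ^ (i : ℕ)))) ∧
    -- (3)
    (¬ (2 : ℤ) ∣ m →
      (m ≡ 1 [ZMOD 8] →
        padicValNat 2 (integerIndex θ) = 9 ∧
        IsPIntegralBasis 2
          (let g : K := θ ^ 9 + θ ^ 6 + θ ^ 3 + 1
           ![1, θ, θ ^ 2, θ ^ 3, θ ^ 4, θ ^ 5,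
             (θ ^ 6 - 1) / 2, θ * (θ ^ 6 - 1) / 2, θ ^ 2 * (θ ^ 6 - 1) / 2,
             g / 2 ^ 2, θ * g / 2 ^ 2, θ ^ 2 * g / 2 ^ 2])) ∧
      (m ≡ 5 [ZMOD 8] →
        padicValNat 2 (integerIndex θ) = 6 ∧
        IsPIntegralBasis 2
          ![1, θ, θ ^ 2, θ ^ 3, θ ^ 4, θ ^ 5,
            (θ ^ 6 - 1) / 2, θ * (θ ^ 6 - 1) / 2, θ ^ 2 * (θ ^ 6 - 1) / 2,
            θ ^ 3 * (θ ^ 6 - 1) / 2, θ ^ 4 * (θ ^ 6 - 1) / 2, θ ^ 5 * (θ ^ 6 - 1) / 2]) ∧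
      (m ≡ 3 [ZMOD 4] →
        padicValNat 2 (integerIndex θ) = 0 ∧
        IsPIntegralBasis 2 (fun i : Fin 12 => θ ^ (i : ℕ)))) ∧
    -- (4)
    (∀ p : ℕ, p.Prime → ¬ (p : ℤ) ∣ 12 * m →
      padicValNat p (integerIndex θ) = 0 ∧
      IsPIntegralBasis p (fun i : Fin 12 => θ ^ (i : ℕ))) := by
  have hm0 : m ≠ 0 := by
    rintro rfl
    exact absurd (hfree 0 (dvd_zero _)) not_isUnit_zero
  have hFact2 : Fact (Nat.Prime 2) := ⟨Nat.prime_two⟩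
  have hFact3 : Fact (Nat.Prime 3) := ⟨Nat.prime_three⟩
  refine ⟨?_, fun p hp hpm hv => ?_, fun hm => ⟨fun h9 => ?_, fun h9 => ?_⟩,
    fun hm => ⟨fun h8 => ?_, fun h8 => ?_, fun h4 => ?_⟩, fun p hp hpm => ?_⟩
  · obtain ⟨B, hB, -⟩ := exists_basis_pow hirr hθ hK
    exact integerIndex_ne_zero (f := Polynomial.X ^ 12 - Polynomial.C m)
      (Polynomial.monic_X_pow_sub_C _ (by norm_num)) Polynomial.natDegree_X_pow_sub_C
      (by simp [hθ]) B hB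
  · have : Fact p.Prime := ⟨hp⟩
    obtain ⟨N, hN, hN12, hsep⟩ := exists_dvd_twelve_separating hp hv
    obtain ⟨hind, hbasis⟩ :=
      isPIntegralBasis_pow_div_prime_pow hirr hθ hK hm0 hN hN12 hsep
    refine ⟨?_, isPIntegralBasis_succ_of_isPIntegralBasis hirr hθ hK hm0 hbasis⟩
    have hpos : 1 ≤ padicValInt p m := by
      have := (padicValInt_dvd_iff 1 m).1 (by rwa [pow_one])
      exact this.resolve_left hm0
    have hlt : padicValInt p m < 12 := by
      by_contra hge
      have h12 := (padicValInt_dvd_iff (p := p) 12 m).2 (Or.inr (not_lt.1 hge))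
      exact (Nat.prime_iff_prime_int.1 hp).not_isUnit (hfree p h12)
    rw [hind]
    generalize padicValInt p m = v at hpos hlt
    interval_cases v <;> simp [Fin.sum_univ_succ] <;> norm_num
  · exact isPIntegralBasis_three_of_modEq hirr hθ hK hm h9
  · refine isPIntegralBasis_pow hirr hθ hK fun c hc i hi => ?_
    have key := fun r hr =>
      cubic_coeff_mem_of_not_modEq hm h9 (cubic_coeff_mem_unitBall hm hc (r := r) hr)
    have k0 := key 0 (by norm_num)
    have k1 := key 1 (by norm_num)
    have k2 := key 2 (by norm_num)
    have k3 := key 3 (by norm_num)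
    interval_cases i <;> simp_all
  · exact isPIntegralBasis_two_of_modEq_one hirr hθ hK h8
  · exact isPIntegralBasis_two_of_modEq_five hirr hθ hK h8
  · refine isPIntegralBasis_pow hirr hθ hK fun c hc i hi => ?_
    have key := fun r hr =>
      quartic_coeff_mem_of_modEq_three h4 (quartic_coeff_mem_unitBall hm hc (r := r) hr)
    have k0 := key 0 (by norm_num)
    have k1 := key 1 (by norm_num)
    have k2 := key 2 (by norm_num)
    interval_cases i <;> simp_all
  · have : Fact p.Prime := ⟨hp⟩
    have hm : ¬ (p : ℤ) ∣ m := fun h => hpm (h.mul_left 12)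
    have h12 : ¬ p ∣ 12 := fun h => hpm ((by exact_mod_cast h : (p : ℤ) ∣ 12).mul_right m)
    refine isPIntegralBasis_pow hirr hθ hK fun c hc i hi => ?_
    have h := mul_pow_mem_localizedIntegers hm0 hc h12 dvd_rfl
      (fun k _ => ⟨k, by push_cast; ring⟩) hi
    rwa [padicValInt.eq_zero_of_not_dvd hm, mul_zero, Nat.zero_div, pow_zero, mul_one] at h
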